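/- Let $f$ be a non-negative multiplicative arithmetic function (with $f(1)=1$) such that $f(n)=O(n^{\varepsilon})$ for some $0<\varepsilon<\tfrac12$. Suppose that for $\operatorname{Re} s>1$ the Dirichlet series $F(s)=\sum_{n\ge 1} f(n)n^{-s}$ converges and satisfies $F(s)=\sqrt{\zeta(s)}\,\Phi(s)$, where $\sqrt{\zeta(s)}$ denotes the holomorphic branch of the square root of the Riemann zeta function in $\operatorname{Re} s>1$ that is positive for real $s>1$, and where $\Phi$ is holomorphic in the half-plane $\operatorname{Re} s>\tfrac12$ and satisfies, for some $c>0$, \[ |\Phi(\sigma+it)|\ll\max\bigl\{1,(\sigma-\tfrac12)^{-c}\bigr\} \] uniformly for all $\sigma>\tfrac12$ and all real $t$. Then, for all real $x>1$, \[ \sum_{n\le x}f(n)=\frac{x}{\sqrt{\ln x}}\left(\frac{\Phi(1)}{\sqrt{\pi}}+O\!\left(\frac1{\ln x}\right)\right), \] where the constant in the symbol $O$ depends only on $f$. -/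

import Mathlib

open Filter Asymptotics

/-- The branch of `√ζ(s)` in the half-plane `Re s > 1` that is holomorphic there and positive on
the real half-line `s > 1`. It is given by the Euler product,
`√ζ(s) = exp (½ ∑_p -log (1 - p^{-s}))`. It is not the principal square root of the value `ζ(s)`,
which is discontinuous in `Re s > 1`. The three lemmas `sqrtZeta_sq`, `differentiableOn_sqrtZeta`
and `sqrtZeta_ofReal` below show that it has the stated properties, which determine it. -/
noncomputable def sqrtZeta (s : ℂ) : ℂ :=
  Complex.exp ((1 / 2 : ℂ) * ∑' p : Nat.Primes, -Complex.log (1 - (p : ℂ) ^ (-s)))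

theorem sqrtZeta_sq {s : ℂ} (hs : 1 < s.re) : sqrtZeta s ^ 2 = riemannZeta s := by
  rw [sqrtZeta, ← Complex.exp_nat_mul, ← riemannZeta_eulerProduct_exp_log hs]
  congr 1
  push_cast
  ring

theorem differentiableOn_sqrtZeta : DifferentiableOn ℂ sqrtZeta {s : ℂ | 1 < s.re} := by
  intro s hs
  obtain ⟨a, ha1, has⟩ := exists_between (show (1 : ℝ) < s.re from hs)
  have hopen : IsOpen {z : ℂ | a < z.re} := isOpen_lt continuous_const Complex.continuous_re
  have hle : ∀ (p : Nat.Primes) (z : ℂ), a < z.re →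
      ‖(p : ℂ) ^ (-z)‖ ≤ ((p : ℕ) : ℝ) ^ (-a) ∧ ‖(p : ℂ) ^ (-z)‖ ≤ 1 / 2 := by
    intro p z hz
    have h2 : (2 : ℝ) ≤ ((p : ℕ) : ℝ) := by exact_mod_cast p.2.two_le
    have hn : ‖(p : ℂ) ^ (-z)‖ = ((p : ℕ) : ℝ) ^ (-z.re) := by
      rw [Complex.norm_natCast_cpow_of_pos p.2.pos, Complex.neg_re]
    rw [hn]
    constructor
    · exact Real.rpow_le_rpow_of_exponent_le (by linarith) (by linarith)
    · calc ((p : ℕ) : ℝ) ^ (-z.re) ≤ ((p : ℕ) : ℝ) ^ (-1 : ℝ) :=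
            Real.rpow_le_rpow_of_exponent_le (by linarith) (by linarith)
        _ = 1 / ((p : ℕ) : ℝ) := by rw [Real.rpow_neg_one, one_div]
        _ ≤ 1 / 2 := one_div_le_one_div_of_le (by norm_num) h2
  have hsum : Summable fun p : Nat.Primes => 3 / 2 * ((p : ℕ) : ℝ) ^ (-a) :=
    (Nat.Primes.summable_rpow.mpr (by linarith)).mul_left _
  have hd : DifferentiableOn ℂ
      (fun z : ℂ => ∑' p : Nat.Primes, -Complex.log (1 - (p : ℂ) ^ (-z))) {z : ℂ | a < z.re} := by
    refine Complex.differentiableOn_tsum_of_summable_norm hsum ?_ hopen ?_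
    · intro p z hz
      have h0 : (p : ℂ) ≠ 0 := by exact_mod_cast p.2.ne_zero
      have hlt := (hle p z hz).2
      refine DifferentiableAt.differentiableWithinAt ?_
      refine (DifferentiableAt.clog ?_ ?_).neg
      · exact (differentiableAt_const _).sub
          (DifferentiableAt.const_cpow differentiableAt_id.neg (Or.inl h0))
      · left
        have := Complex.re_le_norm ((p : ℂ) ^ (-z))
        simp only [Complex.sub_re, Complex.one_re]
        linarith
    · intro p z hz
      have h := hle p z hz
      have h3 := Complex.norm_log_one_add_half_le_self (z := -(p : ℂ) ^ (-z))
        (by rw [norm_neg]; exact h.2)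
      rw [norm_neg] at h3 ⊢
      rw [sub_eq_add_neg]
      linarith [h.1]
  have hat := (hd s has).differentiableAt (hopen.mem_nhds has)
  have : DifferentiableAt ℂ sqrtZeta s := (hat.const_mul (1 / 2 : ℂ)).cexp
  exact this.differentiableWithinAt

theorem sqrtZeta_ofReal {σ : ℝ} (hσ : 1 < σ) :
    ∃ y : ℝ, 0 < y ∧ sqrtZeta (σ : ℂ) = (y : ℂ) := by
  refine ⟨Real.exp (1 / 2 * ∑' p : Nat.Primes, -Real.log (1 - ((p : ℕ) : ℝ) ^ (-σ))),
    Real.exp_pos _, ?_⟩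
  have h : ∀ p : Nat.Primes, -Complex.log (1 - (p : ℂ) ^ (-(σ : ℂ)))
      = ((-Real.log (1 - ((p : ℕ) : ℝ) ^ (-σ)) : ℝ) : ℂ) := by
    intro p
    have h1 : ((p : ℕ) : ℝ) ^ (-σ) ≤ 1 :=
      Real.rpow_le_one_of_one_le_of_nonpos (by exact_mod_cast p.2.one_le) (by linarith)
    rw [Complex.ofReal_neg, Complex.ofReal_log (by linarith), Complex.ofReal_sub,
      Complex.ofReal_cpow (Nat.cast_nonneg _)]
    simp
  rw [sqrtZeta, tsum_congr h, ← Complex.ofReal_tsum]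
  push_cast
  rfl

/-! Write `F = √ζ · Φ`, `x = exp L`. No contour is moved and no zero-free region is used: everything
happens on the line `Re s = 1 + 1/L`, after differentiating `F` twice.

The series of `F''` has coefficients `f n * (log n)²`. Near `s = 1` it equals `(3/4) Φ(1)
(s-1)^(-5/2)` up to `O(|s-1|^(-3/2))`. Two derivatives are what makes the error estimate work:
`|s-1|^(-3/2)` is integrable along the line away from the pole, and its integral is of order `√L`,
against `L^(3/2)` for the main term, so absolute values already give the relative error `1/L`. The
main term is taken as `(3/8) Φ(1) s (s+1) (s-1)^(-5/2)`, because `s (s+1)` cancels the Riesz kernel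
and leaves an exact inverse Laplace transform (`integral_vertical_cpow_mul_cexp`).

Away from `s = 1` it suffices that `F''` is `O((1+|t|)^(1/4))` (`exists_norm_deriv_sqrtZeta_le`).
This comes from upper bounds for `ζ` slightly to the left of `Re s = 1`, Cauchy's estimates, and a
lower bound for `|ζ|` from the 3-4-1 inequality (`exists_le_norm_riemannZeta`), which is needed to
divide by `√ζ`. The factor `Φ` enters through its boundedness on `Re s ≥ 3/4`.

Perron's formula with kernel `1/(s(s+1))` gives the Riesz sums of `f n * (log n)²`. Non-negativity
traps the plain sum between difference quotients of these Riesz sums over steps `± x/L`. The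
differences are estimated inside the integral, so that the short step costs nothing in the error
(`exists_abs_sum_sub_le`). Finally the weight `(log n)²` is replaced by `L²`
(`exists_abs_sum_sub_div_sqrt_le`), since on average `L - log n` is bounded. -/

/-! ### Euler–Maclaurin continuation and upper bounds for `ζ` near `Re s = 1` -/

/-- The `n`-th correction term in the Euler–Maclaurin expansion of `(s - 1) ζ(s)`. -/
noncomputable def zetaRemainder (n : ℕ) (s : ℂ) : ℂ :=
  (s - 1) * ((n + 1 : ℕ) : ℂ) ^ (-s) + ((n + 1 : ℕ) : ℂ) ^ (1 - s) - (n : ℂ) ^ (1 - s)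

/-- The remainder is `s - 1` times the difference between `(n+1)^(-s)` and the integral of `v^(-s)`
over `[n, n+1]`. One integration by parts gains a power of `n`, which gives convergence for `Re s >
0`. -/
theorem norm_zetaRemainder_le {n : ℕ} (hn : 0 < n) {s : ℂ} (hs : -1 ≤ s.re) :
    ‖zetaRemainder n s‖ ≤ ‖s‖ * ‖s - 1‖ * (n : ℝ) ^ (-(s.re + 1)) := by
  by_cases h0 : s = 0
  · simp [h0, zetaRemainder]
  by_cases h1 : s = 1
  · simp [h1, zetaRemainder]
  have hn0 : (0 : ℝ) < n := by exact_mod_cast hn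
  -- The increment of this function over `[n, n+1]` is exactly the remainder, and in its derivative
  -- the terms of order `v^(-s)` cancel.
  have hd : ∀ v : ℝ, 0 < v → HasDerivAt
      (fun v : ℝ => (s - 1) * (((v - n : ℝ) : ℂ) * (v : ℂ) ^ (-s)) + (v : ℂ) ^ (1 - s))
      (-s * (s - 1) * ((v - n : ℝ) : ℂ) * (v : ℂ) ^ (-s - 1)) v := by
    intro v hv
    have e1 : HasDerivAt (fun v : ℝ => ((v - n : ℝ) : ℂ)) 1 v := by
      simpa using ((hasDerivAt_id v).sub_const (n : ℝ)).ofReal_comp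
    have e2 := hasDerivAt_ofReal_cpow_const hv.ne' (neg_ne_zero.mpr h0)
    have e3 := hasDerivAt_ofReal_cpow_const hv.ne' (sub_ne_zero.mpr (Ne.symm h1))
    refine (((e1.mul e2).const_mul (s - 1)).add e3).congr_deriv ?_
    have : (1 - s - 1 : ℂ) = -s := by ring
    rw [this]
    ring
  have key := norm_image_sub_le_of_norm_deriv_le_segment'
    (f := fun v : ℝ => (s - 1) * (((v - n : ℝ) : ℂ) * (v : ℂ) ^ (-s)) + (v : ℂ) ^ (1 - s))
    (a := n) (b := n + 1) (C := ‖s‖ * ‖s - 1‖ * (n : ℝ) ^ (-(s.re + 1)))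
    (fun v hv => (hd v (hn0.trans_le hv.1)).hasDerivWithinAt) ?_ (n + 1) (by simp)
  · simpa [zetaRemainder] using key
  · intro v hv
    have hv0 : 0 < v := hn0.trans_le hv.1
    rw [norm_mul, norm_mul, norm_mul, norm_neg, Complex.norm_real,
      Complex.norm_cpow_eq_rpow_re_of_pos hv0]
    have e1 : ‖v - n‖ ≤ 1 := by
      rw [Real.norm_eq_abs, abs_le]; constructor <;> linarith [hv.1, hv.2]
    have e2 : v ^ (-s - 1).re ≤ (n : ℝ) ^ (-(s.re + 1)) := by
      have : (-s - 1).re = -(s.re + 1) := by simp; ring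
      rw [this]
      exact Real.rpow_le_rpow_of_nonpos hn0 hv.1 (by linarith)
    calc ‖s‖ * ‖s - 1‖ * ‖v - n‖ * v ^ (-s - 1).re
        ≤ ‖s‖ * ‖s - 1‖ * 1 * (n : ℝ) ^ (-(s.re + 1)) := by gcongr
      _ = _ := by ring

theorem differentiable_zetaRemainder {n : ℕ} (hn : 0 < n) :
    Differentiable ℂ (zetaRemainder n) := by
  have h0 : (n : ℂ) ≠ 0 := by exact_mod_cast hn.ne'
  have h1 : ((n + 1 : ℕ) : ℂ) ≠ 0 := by exact_mod_cast n.succ_ne_zero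
  intro s
  unfold zetaRemainder
  refine ((DifferentiableAt.mul (by fun_prop) ?_).add ?_).sub ?_
  · exact DifferentiableAt.const_cpow (by fun_prop) (Or.inl h1)
  · exact DifferentiableAt.const_cpow (by fun_prop) (Or.inl h1)
  · exact DifferentiableAt.const_cpow (by fun_prop) (Or.inl h0)

/-- Telescoping. The cut-off `N` stays free so that it can later be chosen in terms of `Im s`. -/
theorem sum_zetaRemainder (N m : ℕ) (s : ℂ) :
    (s - 1) * ∑ k ∈ Finset.range N, ((k + 1 : ℕ) : ℂ) ^ (-s) + (N : ℂ) ^ (1 - s)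
      + ∑ k ∈ Finset.range m, zetaRemainder (N + k) s
    = (s - 1) * ∑ k ∈ Finset.range (N + m), ((k + 1 : ℕ) : ℂ) ^ (-s)
      + ((N + m : ℕ) : ℂ) ^ (1 - s) := by
  induction m with
  | zero => simp
  | succ m ih =>
    rw [Finset.sum_range_succ, ← add_assoc, ih, ← add_assoc N m 1, Finset.sum_range_succ,
      zetaRemainder]
    ring

theorem summable_natCast_add_rpow_neg (N : ℕ) {a : ℝ} (ha : 1 < a) :
    Summable fun k : ℕ => ((N + k : ℕ) : ℝ) ^ (-a) := by
  have := (summable_nat_add_iff N).mpr (Real.summable_nat_rpow.mpr (by linarith : -a < -1))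
  simpa [add_comm] using this

theorem riemannZeta₁_eq_of_one_lt_re {N : ℕ} (hN : 0 < N) {s : ℂ} (hs : 1 < s.re) :
    riemannZeta₁ s = (s - 1) * ∑ k ∈ Finset.range N, ((k + 1 : ℕ) : ℂ) ^ (-s)
      + (N : ℂ) ^ (1 - s) + ∑' k, zetaRemainder (N + k) s := by
  have hs1 : s ≠ 1 := by rintro rfl; simp at hs
  have hz : riemannZeta₁ s = (s - 1) * riemannZeta s := by
    rw [riemannZeta_eq_inv_sub_mul hs1, mul_inv_cancel_left₀ (sub_ne_zero.mpr hs1)]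
  have hsum : Summable fun k => zetaRemainder (N + k) s := by
    refine Summable.of_norm_bounded
      ((summable_natCast_add_rpow_neg N (show 1 < s.re + 1 by linarith)).mul_left
        (‖s‖ * ‖s - 1‖)) fun k => ?_
    exact norm_zetaRemainder_le (by omega) (by linarith)
  have l1 := (hsum.hasSum.tendsto_sum_nat).const_add
    ((s - 1) * ∑ k ∈ Finset.range N, ((k + 1 : ℕ) : ℂ) ^ (-s) + (N : ℂ) ^ (1 - s))
  simp_rw [sum_zetaRemainder] at l1
  have hts : Summable fun k : ℕ => ((k + 1 : ℕ) : ℂ) ^ (-s) := by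
    have := (summable_nat_add_iff 1).mpr (Complex.summable_one_div_nat_cpow.mpr hs)
    refine this.congr fun k => ?_
    rw [Complex.cpow_neg, one_div]
  have hzs : HasSum (fun k : ℕ => ((k + 1 : ℕ) : ℂ) ^ (-s)) (riemannZeta s) := by
    rw [zeta_eq_tsum_one_div_nat_add_one_cpow hs]
    convert hts.hasSum using 3 with k
    rw [Complex.cpow_neg, one_div]; push_cast; rfl
  have hadd : Tendsto (fun m : ℕ => N + m) atTop atTop :=
    tendsto_atTop_mono (fun m => Nat.le_add_left m N) tendsto_id
  have l2 : Tendsto (fun n : ℕ => (n : ℂ) ^ (1 - s)) atTop (nhds 0) := by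
    rw [tendsto_zero_iff_norm_tendsto_zero]
    have := (tendsto_rpow_neg_atTop (show 0 < s.re - 1 by linarith)).comp
      (tendsto_natCast_atTop_atTop (R := ℝ))
    refine this.congr' ?_
    filter_upwards [eventually_gt_atTop 0] with n hn
    rw [Complex.norm_natCast_cpow_of_pos hn]
    simp
  have l3 := ((hzs.tendsto_sum_nat.const_mul (s - 1)).add l2).comp hadd
  rw [hz]
  simpa using tendsto_nhds_unique l3 l1

/-- Both sides are holomorphic and agree for `Re s > 1`, so the identity theorem applies. Working
inside a ball that contains both `s` and `2` bounds the factor `‖s‖ * ‖s - 1‖` uniformly, as the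
convergence of the remainder series requires. -/
theorem riemannZeta₁_eq {N : ℕ} (hN : 0 < N) {s : ℂ} (hs : 1 / 2 < s.re) :
    riemannZeta₁ s = (s - 1) * ∑ k ∈ Finset.range N, ((k + 1 : ℕ) : ℂ) ^ (-s)
      + (N : ℂ) ^ (1 - s) + ∑' k, zetaRemainder (N + k) s := by
  set R : ℝ := ‖s‖ + 3
  set U : Set ℂ := {z | 1 / 2 < z.re} ∩ Metric.ball 0 R
  have hUo : IsOpen U :=
    (isOpen_lt continuous_const Complex.continuous_re).inter Metric.isOpen_ball
  have hUc : Convex ℝ U := (convex_halfSpace_re_gt _).inter (convex_ball _ _)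
  have hsU : s ∈ U := ⟨hs, by simp [R]⟩
  have h2U : (2 : ℂ) ∈ U := ⟨by norm_num, by simp [R]; linarith [norm_nonneg s]⟩
  have hN0 : (N : ℂ) ≠ 0 := by exact_mod_cast hN.ne'
  have hdt : DifferentiableOn ℂ (fun z => ∑' k, zetaRemainder (N + k) z) U := by
    refine Complex.differentiableOn_tsum_of_summable_norm
      ((summable_natCast_add_rpow_neg N (show (1 : ℝ) < 3 / 2 by norm_num)).mul_left
        (R * (R + 1))) (fun k => (differentiable_zetaRemainder (by omega)).differentiableOn)
      hUo fun k w hw => ?_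
    have hwR : ‖w‖ ≤ R := (mem_ball_zero_iff.mp hw.2).le
    have hw1 : ‖w - 1‖ ≤ R + 1 := (norm_sub_le _ _).trans (by simpa using hwR)
    have hwr : 1 / 2 < w.re := hw.1
    refine (norm_zetaRemainder_le (by omega) (by linarith)).trans ?_
    have h1 : (1 : ℝ) ≤ ((N + k : ℕ) : ℝ) := by exact_mod_cast (by omega : 1 ≤ N + k)
    gcongr
    linarith
  have hda : DifferentiableOn ℂ (fun z => (z - 1) * ∑ k ∈ Finset.range N,
      ((k + 1 : ℕ) : ℂ) ^ (-z) + (N : ℂ) ^ (1 - z) + ∑' k, zetaRemainder (N + k) z) U := by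
    refine DifferentiableOn.add (Differentiable.differentiableOn fun z => ?_) hdt
    refine DifferentiableAt.add (DifferentiableAt.mul (by fun_prop) ?_) ?_
    · refine DifferentiableAt.fun_sum fun k _ => ?_
      exact DifferentiableAt.const_cpow (by fun_prop)
        (Or.inl (by exact_mod_cast k.succ_ne_zero))
    · exact DifferentiableAt.const_cpow (by fun_prop) (Or.inl hN0)
  refine AnalyticOnNhd.eqOn_of_preconnected_of_eventuallyEq
    (differentiable_riemannZeta₁.differentiableOn.analyticOnNhd hUo) (hda.analyticOnNhd hUo)
    hUc.isPreconnected h2U ?_ hsU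
  filter_upwards [(isOpen_lt continuous_const Complex.continuous_re).mem_nhds
    (show (1 : ℝ) < (2 : ℂ).re by norm_num)] with z hz
  exact riemannZeta₁_eq_of_one_lt_re hN hz

/-- With a cut-off `N` of size `T²`, `T = 1 + |Im s|`, the partial sum and `N^(1-s)` cost at most
about `N^(1/64)`, that is `T^(1/32)`. The remainder after division by `s - 1` is bounded. Any small
exponent would serve; `1/32` leaves room for the losses that follow. -/
theorem norm_riemannZeta_le {ρ : ℝ} (hρ : 0 < ρ) :
    ∃ C : ℝ, 0 < C ∧ ∀ s : ℂ, 127 / 128 ≤ s.re → s.re ≤ 3 → ρ ≤ |s.im| →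
      ‖riemannZeta s‖ ≤ C * (1 + |s.im|) ^ (1 / 32 : ℝ) := by
  set A : ℝ := ∑' k : ℕ, ((1 + k : ℕ) : ℝ) ^ (-(129 / 128) : ℝ)
  set D : ℝ := ∑' k : ℕ, ((1 + k : ℕ) : ℝ) ^ (-(5 / 4) : ℝ)
  have hA : Summable fun k : ℕ => ((1 + k : ℕ) : ℝ) ^ (-(129 / 128) : ℝ) :=
    summable_natCast_add_rpow_neg 1 (by norm_num)
  have hD : Summable fun k : ℕ => ((1 + k : ℕ) : ℝ) ^ (-(5 / 4) : ℝ) :=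
    summable_natCast_add_rpow_neg 1 (by norm_num)
  have hA0 : 0 ≤ A := tsum_nonneg fun k => by positivity
  have hD0 : 0 ≤ D := tsum_nonneg fun k => by positivity
  refine ⟨2 * A + 2 / ρ + 3 * D, by positivity, fun s hs hs3 ht => ?_⟩
  set T : ℝ := 1 + |s.im|
  have hT : 1 ≤ T := by simp [T]
  set N : ℕ := ⌈T ^ 2⌉₊
  have hNT : T ^ 2 ≤ N := Nat.le_ceil _
  have hN2 : (N : ℝ) ≤ 2 * T ^ 2 := by
    have := Nat.ceil_lt_add_one (show 0 ≤ T ^ 2 by positivity)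
    have : (1 : ℝ) ≤ T ^ 2 := one_le_pow₀ hT
    linarith
  have hN1 : (1 : ℝ) ≤ N := (one_le_pow₀ hT).trans hNT
  have hN : 0 < N := by exact_mod_cast hN1
  have hs1 : ρ ≤ ‖s - 1‖ := ht.trans (by simpa using Complex.abs_im_le_norm (s - 1))
  have hs0 : s - 1 ≠ 0 := norm_pos_iff.mp (hρ.trans_le hs1)
  have hnorm : ‖s‖ ≤ 3 * T := by
    have := Complex.norm_le_abs_re_add_abs_im s
    rw [abs_of_nonneg (by linarith)] at this
    simp only [T]
    linarith [abs_nonneg s.im]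
  have hY : (N : ℝ) ^ (1 / 64 : ℝ) ≤ 2 * T ^ (1 / 32 : ℝ) := by
    calc (N : ℝ) ^ (1 / 64 : ℝ) ≤ (2 * T ^ 2) ^ (1 / 64 : ℝ) := by gcongr
      _ = 2 ^ (1 / 64 : ℝ) * T ^ (1 / 32 : ℝ) := by
          rw [Real.mul_rpow (by norm_num) (by positivity), ← Real.rpow_natCast T 2,
            ← Real.rpow_mul (by positivity)]
          norm_num
      _ ≤ 2 * T ^ (1 / 32 : ℝ) := by
          gcongr
          exact (Real.rpow_le_rpow_of_exponent_le (by norm_num) (by norm_num)).trans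
            (Real.rpow_one 2).le
  have b1 : ‖∑ k ∈ Finset.range N, ((k + 1 : ℕ) : ℂ) ^ (-s)‖ ≤ 2 * A * T ^ (1 / 32 : ℝ) := by
    calc ‖∑ k ∈ Finset.range N, ((k + 1 : ℕ) : ℂ) ^ (-s)‖
        ≤ ∑ k ∈ Finset.range N,
          (N : ℝ) ^ (1 / 64 : ℝ) * ((1 + k : ℕ) : ℝ) ^ (-(129 / 128) : ℝ) := by
          refine norm_sum_le_of_le _ fun k hk => ?_
          rw [Complex.norm_natCast_cpow_of_pos k.succ_pos, add_comm 1 k, Complex.neg_re]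
          have h1 : (1 : ℝ) ≤ ((k + 1 : ℕ) : ℝ) := by exact_mod_cast k.succ_pos
          have hkN : ((k + 1 : ℕ) : ℝ) ≤ N := by
            exact_mod_cast Nat.succ_le_of_lt (Finset.mem_range.mp hk)
          calc ((k + 1 : ℕ) : ℝ) ^ (-s.re)
              ≤ ((k + 1 : ℕ) : ℝ) ^ ((1 / 64 : ℝ) + -(129 / 128)) :=
                Real.rpow_le_rpow_of_exponent_le h1 (by linarith)
            _ = ((k + 1 : ℕ) : ℝ) ^ (1 / 64 : ℝ) * ((k + 1 : ℕ) : ℝ) ^ (-(129 / 128) : ℝ) :=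
                Real.rpow_add (by linarith) _ _
            _ ≤ _ := by gcongr
      _ = (N : ℝ) ^ (1 / 64 : ℝ) * ∑ k ∈ Finset.range N,
            ((1 + k : ℕ) : ℝ) ^ (-(129 / 128) : ℝ) := by rw [Finset.mul_sum]
      _ ≤ 2 * T ^ (1 / 32 : ℝ) * A := by
          gcongr
          exact hA.sum_le_tsum _ fun k _ => by positivity
      _ = _ := by ring
  have b2 : ‖(N : ℂ) ^ (1 - s)‖ ≤ 2 * T ^ (1 / 32 : ℝ) := by
    rw [Complex.norm_natCast_cpow_of_pos hN]
    refine (Real.rpow_le_rpow_of_exponent_le hN1 ?_).trans hY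
    simp only [Complex.sub_re, Complex.one_re]
    linarith
  have b3 : ‖∑' k, zetaRemainder (N + k) s‖ ≤ 3 * D * T ^ (1 / 32 : ℝ) * ‖s - 1‖ := by
    have hbd : ∀ k : ℕ, ‖zetaRemainder (N + k) s‖ ≤
        3 * ‖s - 1‖ * ((1 + k : ℕ) : ℝ) ^ (-(5 / 4) : ℝ) := by
      intro k
      refine (norm_zetaRemainder_le (by omega) (by linarith)).trans ?_
      have hk1 : (1 : ℝ) ≤ ((N + k : ℕ) : ℝ) := by exact_mod_cast (by omega : 1 ≤ N + k)
      have hNk : (N : ℝ) ≤ ((N + k : ℕ) : ℝ) := by exact_mod_cast N.le_add_right k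
      have hk : ((1 + k : ℕ) : ℝ) ≤ ((N + k : ℕ) : ℝ) := by exact_mod_cast (by omega)
      -- Half a power of `N + k` is spent on cancelling the factor `‖s‖ ≤ 3T`; the remaining
      -- exponent `5/4` still gives a convergent series.
      have hTr : ((N + k : ℕ) : ℝ) ^ (-(1 / 2) : ℝ) ≤ T⁻¹ := by
        calc ((N + k : ℕ) : ℝ) ^ (-(1 / 2) : ℝ) ≤ (T ^ 2) ^ (-(1 / 2) : ℝ) :=
              Real.rpow_le_rpow_of_nonpos (by positivity) (hNT.trans hNk) (by norm_num)
          _ = T⁻¹ := by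
              rw [← Real.rpow_natCast T 2, ← Real.rpow_mul (by positivity), ← Real.rpow_neg_one]
              norm_num
      calc ‖s‖ * ‖s - 1‖ * ((N + k : ℕ) : ℝ) ^ (-(s.re + 1))
          ≤ 3 * T * ‖s - 1‖ * ((N + k : ℕ) : ℝ) ^ (-(1 / 2) + -(5 / 4) : ℝ) := by
            gcongr
            linarith
        _ = 3 * T * ‖s - 1‖ * (((N + k : ℕ) : ℝ) ^ (-(1 / 2) : ℝ)
              * ((N + k : ℕ) : ℝ) ^ (-(5 / 4) : ℝ)) := by
            rw [Real.rpow_add (by linarith)]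
        _ ≤ 3 * T * ‖s - 1‖ * (T⁻¹ * ((1 + k : ℕ) : ℝ) ^ (-(5 / 4) : ℝ)) := by
            refine mul_le_mul_of_nonneg_left (mul_le_mul hTr ?_ (by positivity)
              (by positivity)) (by positivity)
            exact Real.rpow_le_rpow_of_nonpos (by positivity) hk (by norm_num)
        _ = _ := by field_simp
    refine (tsum_of_norm_bounded (hD.hasSum.mul_left _) hbd).trans ?_
    have : (1 : ℝ) ≤ T ^ (1 / 32 : ℝ) := Real.one_le_rpow hT (by norm_num)
    calc 3 * ‖s - 1‖ * D = 3 * D * 1 * ‖s - 1‖ := by ring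
      _ ≤ _ := by gcongr
  rw [riemannZeta_eq_inv_sub_mul (sub_ne_zero.mp hs0), riemannZeta₁_eq hN (by linarith), mul_add,
    mul_add, inv_mul_cancel_left₀ hs0]
  have hY0 : 0 ≤ T ^ (1 / 32 : ℝ) := by positivity
  calc _ ≤ 2 * A * T ^ (1 / 32 : ℝ) + ρ⁻¹ * (2 * T ^ (1 / 32 : ℝ))
        + ‖s - 1‖⁻¹ * (3 * D * T ^ (1 / 32 : ℝ) * ‖s - 1‖) := by
        refine norm_add₃_le.trans ?_
        rw [norm_mul, norm_mul, norm_inv]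
        gcongr
    _ = _ := by
        have : ‖s - 1‖ ≠ 0 := norm_ne_zero_iff.mpr hs0
        field_simp

/-- Cauchy's estimate on a circle of fixed radius. The radius is at most `1/128`, to remain in the
strip of the previous bound, and at most `ρ/2`, to avoid the pole. -/
theorem norm_iteratedDeriv_riemannZeta_le {ρ : ℝ} (hρ : 0 < ρ) (n : ℕ) :
    ∃ C : ℝ, 0 < C ∧ ∀ s : ℂ, 1 ≤ s.re → s.re ≤ 2 → ρ ≤ |s.im| →
      ‖iteratedDeriv n riemannZeta s‖ ≤ C * (1 + |s.im|) ^ (1 / 32 : ℝ) := by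
  obtain ⟨C, hC, hb⟩ := norm_riemannZeta_le (half_pos hρ)
  set r : ℝ := min (1 / 128) (ρ / 2)
  have hr : 0 < r := by positivity
  have hr1 : r ≤ 1 / 128 := min_le_left _ _
  have hr2 : r ≤ ρ / 2 := min_le_right _ _
  refine ⟨n.factorial * (C * 2) / r ^ n, by positivity, fun s hs hs2 ht => ?_⟩
  have hball : ∀ z ∈ Metric.closedBall s r, 127 / 128 ≤ z.re ∧ z.re ≤ 3 ∧ ρ / 2 ≤ |z.im| ∧
      |z.im| ≤ |s.im| + 1 := by
    intro z hz
    rw [Metric.mem_closedBall, Complex.dist_eq] at hz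
    have h1 := (Complex.abs_re_le_norm (z - s)).trans hz
    have h2 := (Complex.abs_im_le_norm (z - s)).trans hz
    rw [Complex.sub_re, abs_le] at h1
    rw [Complex.sub_im] at h2
    have h3 := (abs_sub_abs_le_abs_sub z.im s.im).trans h2
    have h4 := abs_sub_abs_le_abs_sub s.im z.im
    rw [abs_sub_comm] at h4
    refine ⟨by linarith, by linarith, by linarith, by linarith⟩
  have hd : DifferentiableOn ℂ riemannZeta (Metric.closedBall s r) := fun z hz => by
    refine (differentiableAt_riemannZeta ?_).differentiableWithinAt
    rintro rfl
    have := (hball 1 hz).2.2.1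
    simp at this
    linarith
  refine (Complex.norm_iteratedDeriv_le_of_forall_mem_sphere_norm_le n hr
    (hd.diffContOnCl_ball subset_rfl) (C := C * 2 * (1 + |s.im|) ^ (1 / 32 : ℝ))
    fun z hz => ?_).trans (le_of_eq (by ring))
  obtain ⟨h1, h2, h3, h4⟩ := hball z (Metric.sphere_subset_closedBall hz)
  refine (hb z h1 h2 h3).trans ?_
  rw [mul_assoc]
  gcongr
  calc (1 + |z.im|) ^ (1 / 32 : ℝ) ≤ (2 * (1 + |s.im|)) ^ (1 / 32 : ℝ) := by
        gcongr
        linarith [abs_nonneg s.im]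
    _ = 2 ^ (1 / 32 : ℝ) * (1 + |s.im|) ^ (1 / 32 : ℝ) :=
        Real.mul_rpow (by norm_num) (by positivity)
    _ ≤ 2 * (1 + |s.im|) ^ (1 / 32 : ℝ) := by
        gcongr
        exact (Real.rpow_le_rpow_of_exponent_le (by norm_num) (by norm_num)).trans
          (Real.rpow_one 2).le

/-! ### Lower bound for `|ζ|` to the right of the line `Re s = 1` -/

theorem one_le_norm_riemannZeta_product {a : ℝ} (ha : 0 < a) (t : ℝ) :
    1 ≤ ‖riemannZeta (1 + a)‖ ^ 3 * ‖riemannZeta (1 + a + Complex.I * t)‖ ^ 4 *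
      ‖riemannZeta (1 + a + 2 * Complex.I * t)‖ := by
  have h := DirichletCharacter.norm_LFunction_product_ge_one (1 : DirichletCharacter ℂ 1) ha t
  rw [DirichletCharacter.LFunctionTrivChar, DirichletCharacter.LFunction_modOne_eq,
    DirichletCharacter.LFunction_modOne_eq, norm_mul, norm_mul, norm_pow, norm_pow] at h
  exact h

theorem exists_norm_riemannZeta_le_inv :
    ∃ B : ℝ, 0 < B ∧ ∀ a : ℝ, 0 < a → a ≤ 1 → ‖riemannZeta (1 + a)‖ ≤ B / a := by
  obtain ⟨B, hB⟩ := (isCompact_closedBall (1 : ℂ) 1).exists_bound_of_continuousOn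
    differentiable_riemannZeta₁.continuous.continuousOn
  refine ⟨max B 1, by positivity, fun a ha ha1 => ?_⟩
  have ha0 : (1 + a : ℂ) ≠ 1 := by simpa using ha.ne'
  rw [riemannZeta_eq_inv_sub_mul ha0, norm_mul, norm_inv, add_sub_cancel_left, Complex.norm_real,
    Real.norm_of_nonneg ha.le, div_eq_inv_mul]
  gcongr
  refine (hB _ ?_).trans (le_max_left _ _)
  simpa [abs_of_pos ha] using ha1

/-- At distance `a` from the line, the 3-4-1 inequality gives `|ζ| ≥ k a^(3/4) / y` with `y` a small
power of `1 + |t|`. This degenerates as `a → 0`, so nearer to the line one compares with the point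
at distance `a₀`, using the bound for `ζ'`. -/
theorem exists_le_norm_riemannZeta {ρ : ℝ} (hρ : 0 < ρ) :
    ∃ κ : ℝ, 0 < κ ∧ ∀ s : ℂ, 1 < s.re → s.re ≤ 2 → ρ ≤ |s.im| →
      κ ≤ ‖riemannZeta s‖ * ((1 + |s.im|) ^ (1 / 32 : ℝ)) ^ 4 := by
  obtain ⟨B, hB, hBa⟩ := exists_norm_riemannZeta_le_inv
  obtain ⟨C, hC, hCb⟩ := norm_iteratedDeriv_riemannZeta_le hρ 0
  obtain ⟨C', hC', hCd⟩ := norm_iteratedDeriv_riemannZeta_le hρ 1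
  simp only [iteratedDeriv_zero, iteratedDeriv_one] at hCb hCd
  set k : ℝ := (1 / (2 * C * B ^ 3)) ^ (1 / 4 : ℝ)
  have hk : 0 < k := by positivity
  have hk4 : k ^ 4 = 1 / (2 * C * B ^ 3) := by
    simp only [k]
    rw [← Real.rpow_natCast, ← Real.rpow_mul (by positivity)]
    norm_num
  set d : ℝ := min 1 (k / (2 * C'))
  have hd : 0 < d := by positivity
  have hd1 : d ≤ 1 := min_le_left _ _
  have hdk : C' * d ≤ k / 2 := by
    have : d ≤ k / (2 * C') := min_le_right _ _
    rw [le_div_iff₀ (by positivity)] at this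
    linarith
  refine ⟨k * d ^ 3 / 2, by positivity, fun s hs hs2 ht => ?_⟩
  set t : ℝ := s.im
  -- The fourth root of the growth factor, so that only integral powers of `y` occur below.
  set y : ℝ := (1 + |t|) ^ (1 / 128 : ℝ)
  have hy1 : 1 ≤ y := Real.one_le_rpow (by simp) (by norm_num)
  have hy4 : (1 + |t|) ^ (1 / 32 : ℝ) = y ^ 4 := by
    simp only [y]
    rw [← Real.rpow_natCast, ← Real.rpow_mul (by positivity)]
    norm_num
  have e16 : (y ^ 4) ^ 4 = y ^ 16 := by ring
  rw [hy4, e16]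
  have key : ∀ a : ℝ, 0 < a → a ≤ 1 →
      k ^ 4 * a ^ 3 ≤ (‖riemannZeta (1 + a + Complex.I * t)‖ * y) ^ 4 := by
    intro a ha ha1
    have h1 := one_le_norm_riemannZeta_product ha t
    have h2 : ‖riemannZeta (1 + a + 2 * Complex.I * t)‖ ≤ 2 * C * y ^ 4 := by
      have him : (1 + a + 2 * Complex.I * t : ℂ).im = 2 * t := by simp
      have hre : (1 + a + 2 * Complex.I * t : ℂ).re = 1 + a := by simp
      refine (hCb _ (by rw [hre]; linarith) (by rw [hre]; linarith) ?_).trans ?_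
      · rw [him, abs_mul, abs_two]; linarith [abs_nonneg t]
      rw [him, ← hy4, abs_mul, abs_two]
      calc C * (1 + 2 * |t|) ^ (1 / 32 : ℝ) ≤ C * (2 * (1 + |t|)) ^ (1 / 32 : ℝ) := by
            gcongr; linarith
        _ = C * (2 ^ (1 / 32 : ℝ) * (1 + |t|) ^ (1 / 32 : ℝ)) := by
            rw [Real.mul_rpow (by norm_num) (by positivity)]
        _ ≤ C * (2 * (1 + |t|) ^ (1 / 32 : ℝ)) := by
            gcongr
            exact (Real.rpow_le_rpow_of_exponent_le (by norm_num) (by norm_num)).trans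
              (Real.rpow_one 2).le
        _ = _ := by ring
    have h3 : 1 ≤ (B / a) ^ 3 * ‖riemannZeta (1 + a + Complex.I * t)‖ ^ 4 * (2 * C * y ^ 4) := by
      refine h1.trans ?_
      gcongr
      exact hBa a ha ha1
    rw [hk4, mul_pow]
    calc 1 / (2 * C * B ^ 3) * a ^ 3
        ≤ 1 / (2 * C * B ^ 3) * a ^ 3 *
          ((B / a) ^ 3 * ‖riemannZeta (1 + a + Complex.I * t)‖ ^ 4 * (2 * C * y ^ 4)) :=
          le_mul_of_one_le_right (by positivity) h3
      _ = _ := by field_simp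
  -- This balances the lower bound `k a^(3/4) / y` against the variation `C' y^4 a`. The choice of
  -- `d` makes the variation at most half of the lower bound.
  set a₀ : ℝ := (d / y ^ 5) ^ 4
  have ha₀ : 0 < a₀ := by positivity
  have ha₀1 : a₀ ≤ 1 := by
    refine pow_le_one₀ (by positivity) ?_
    rw [div_le_one (by positivity)]
    exact hd1.trans (one_le_pow₀ hy1)
  have far : ∀ a : ℝ, a₀ ≤ a → a ≤ 1 →
      k * d ^ 3 ≤ ‖riemannZeta (1 + a + Complex.I * t)‖ * y ^ 16 := by
    intro a ha ha1
    refine le_of_pow_le_pow_left₀ (n := 4) (by norm_num) (by positivity) ?_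
    calc (k * d ^ 3) ^ 4 = k ^ 4 * a₀ ^ 3 * y ^ 60 := by simp only [a₀]; field_simp
      _ ≤ k ^ 4 * a ^ 3 * y ^ 60 := by gcongr
      _ ≤ (‖riemannZeta (1 + a + Complex.I * t)‖ * y) ^ 4 * y ^ 60 := by
          gcongr; exact key a (ha₀.trans_le ha) ha1
      _ = _ := by ring
  have hkd : 0 < k * d ^ 3 := by positivity
  have hseq : s = 1 + ((s.re - 1 : ℝ) : ℂ) + Complex.I * t := by
    apply Complex.ext <;> simp [t]
  rcases le_total a₀ (s.re - 1) with h | h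
  · have := far (s.re - 1) h (by linarith)
    rw [← hseq] at this
    linarith
  · have h1 := far a₀ le_rfl ha₀1
    set w : ℂ := 1 + a₀ + Complex.I * t
    have hwre : w.re = 1 + a₀ := by simp [w]
    have hwim : w.im = t := by simp [w]
    set S : Set ℂ := {z | 1 ≤ z.re} ∩ {z | z.re ≤ 2} ∩ {z | z.im = t}
    have hSc : Convex ℝ S := ((convex_halfSpace_re_ge 1).inter (convex_halfSpace_re_le 2)).inter
      (convex_hyperplane Complex.imLm.isLinear t)
    have hmv := hSc.norm_image_sub_le_of_norm_deriv_le (𝕜 := ℂ) (f := riemannZeta)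
      (C := C' * y ^ 4) (x := s) (y := w) ?_ ?_ ⟨⟨hs.le, hs2⟩, rfl⟩
      ⟨⟨by simp [hwre, ha₀.le], by simp only [Set.mem_ofPred_eq, hwre]; linarith⟩, hwim⟩
    · have hws : ‖w - s‖ ≤ a₀ := by
        have : w - s = ((a₀ - (s.re - 1) : ℝ) : ℂ) := by
          apply Complex.ext
          · simp only [Complex.sub_re, Complex.ofReal_re, hwre]; ring
          · simp only [Complex.sub_im, Complex.ofReal_im, hwim]; simp [t]
        rw [this, Complex.norm_real, Real.norm_eq_abs, abs_le]
        constructor <;> linarith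
      have h2 : ‖riemannZeta w‖ ≤ ‖riemannZeta s‖ + C' * y ^ 4 * a₀ := by
        have := norm_sub_norm_le (riemannZeta w) (riemannZeta s)
        have : C' * y ^ 4 * ‖w - s‖ ≤ C' * y ^ 4 * a₀ := by gcongr
        linarith
      have h3 : C' * y ^ 4 * a₀ * y ^ 16 = C' * d * d ^ 3 := by
        simp only [a₀]; field_simp
      have h4 : C' * d * d ^ 3 ≤ k / 2 * d ^ 3 := by gcongr
      have h5 := mul_le_mul_of_nonneg_right h2 (show 0 ≤ y ^ 16 by positivity)
      linarith
    · rintro z ⟨-, hz⟩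
      refine differentiableAt_riemannZeta ?_
      rintro rfl
      have hz : (0 : ℝ) = t := by simpa using hz
      rw [← hz] at ht
      simp at ht
      linarith
    · rintro z ⟨⟨hz1, hz2⟩, hz⟩
      have hz : z.im = t := hz
      have := hCd z hz1 hz2 (by rw [hz]; exact ht)
      rwa [hz, hy4] at this

/-! ### Growth of `√ζ`, of `√ζ · Φ` and of their derivatives -/

theorem isOpen_re_gt (a : ℝ) : IsOpen {s : ℂ | a < s.re} :=
  isOpen_lt continuous_const Complex.continuous_re

theorem sqrtZeta_ne_zero (s : ℂ) : sqrtZeta s ≠ 0 := Complex.exp_ne_zero _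

theorem two_mul_sqrtZeta_mul_deriv {s : ℂ} (hs : 1 < s.re) :
    2 * sqrtZeta s * deriv sqrtZeta s = deriv riemannZeta s := by
  have hev : (fun z => sqrtZeta z ^ 2) =ᶠ[nhds s] riemannZeta := by
    filter_upwards [(isOpen_re_gt 1).mem_nhds hs] with z hz using sqrtZeta_sq hz
  have hd := (differentiableOn_sqrtZeta s hs).differentiableAt ((isOpen_re_gt 1).mem_nhds hs)
  rw [← hev.deriv_eq, deriv_fun_pow hd]
  simp

theorem two_mul_deriv_sqrtZeta_sq_add {s : ℂ} (hs : 1 < s.re) :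
    2 * deriv sqrtZeta s ^ 2 + 2 * sqrtZeta s * deriv (deriv sqrtZeta) s =
      deriv (deriv riemannZeta) s := by
  have hev : (fun z => 2 * sqrtZeta z * deriv sqrtZeta z) =ᶠ[nhds s] deriv riemannZeta := by
    filter_upwards [(isOpen_re_gt 1).mem_nhds hs] with z hz using two_mul_sqrtZeta_mul_deriv hz
  have hd := (differentiableOn_sqrtZeta s hs).differentiableAt ((isOpen_re_gt 1).mem_nhds hs)
  have hd2 := (differentiableOn_sqrtZeta.deriv (isOpen_re_gt 1) s hs).differentiableAt
    ((isOpen_re_gt 1).mem_nhds hs)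
  rw [← hev.deriv_eq, deriv_fun_mul (hd.const_mul 2) hd2, deriv_const_mul _ hd]
  ring

theorem deriv_deriv_mul {U : Set ℂ} (hU : IsOpen U) {f g : ℂ → ℂ} (hf : DifferentiableOn ℂ f U)
    (hg : DifferentiableOn ℂ g U) {s : ℂ} (hs : s ∈ U) :
    deriv (deriv fun z => f z * g z) s =
      deriv (deriv f) s * g s + 2 * (deriv f s * deriv g s) + f s * deriv (deriv g) s := by
  have at' : ∀ {h : ℂ → ℂ}, DifferentiableOn ℂ h U → ∀ z ∈ U, DifferentiableAt ℂ h z :=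
    fun hh z hz => (hh z hz).differentiableAt (hU.mem_nhds hz)
  have hev : deriv (fun z => f z * g z) =ᶠ[nhds s] fun z => deriv f z * g z + f z * deriv g z := by
    filter_upwards [hU.mem_nhds hs] with z hz using deriv_fun_mul (at' hf z hz) (at' hg z hz)
  have hf' := at' (hf.deriv hU) s hs
  have hg' := at' (hg.deriv hU) s hs
  have hf0 := at' hf s hs
  have hg0 := at' hg s hs
  rw [hev.deriv_eq, deriv_fun_add (hf'.fun_mul hg0) (hf0.fun_mul hg'), deriv_fun_mul hf' hg0,
    deriv_fun_mul hf0 hg']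
  ring

/-- The function `sqrtZeta` and its first two derivatives grow slowly along vertical lines. -/
theorem exists_norm_deriv_sqrtZeta_le {ρ : ℝ} (hρ : 0 < ρ) :
    ∃ M : ℝ, 0 < M ∧ ∀ s : ℂ, 1 < s.re → s.re ≤ 2 → ρ ≤ |s.im| →
      ‖sqrtZeta s‖ ≤ M * (1 + |s.im|) ^ (1 / 4 : ℝ) ∧
      ‖deriv sqrtZeta s‖ ≤ M * (1 + |s.im|) ^ (1 / 4 : ℝ) ∧
      ‖deriv (deriv sqrtZeta) s‖ ≤ M * (1 + |s.im|) ^ (1 / 4 : ℝ) := by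
  obtain ⟨κ, hκ, hlow⟩ := exists_le_norm_riemannZeta hρ
  obtain ⟨C₀, hC₀, h0⟩ := norm_iteratedDeriv_riemannZeta_le hρ 0
  obtain ⟨C₁, hC₁, h1⟩ := norm_iteratedDeriv_riemannZeta_le hρ 1
  obtain ⟨C₂, hC₂, h2⟩ := norm_iteratedDeriv_riemannZeta_le hρ 2
  simp only [iteratedDeriv_zero, iteratedDeriv_one, iteratedDeriv_succ (n := 1)] at h0 h1 h2
  set m : ℝ := √κ
  have hm : 0 < m := Real.sqrt_pos.mpr hκ
  have hm2 : m ^ 2 = κ := Real.sq_sqrt hκ.le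
  refine ⟨√C₀ + C₁ / m + (C₂ + 2 * (C₁ / m) ^ 2) / m, by positivity, fun s hs hs2 ht => ?_⟩
  set Y : ℝ := (1 + |s.im|) ^ (1 / 32 : ℝ)
  have hY1 : 1 ≤ Y := Real.one_le_rpow (by simp) (by norm_num)
  have hY8 : (1 + |s.im|) ^ (1 / 4 : ℝ) = Y ^ 8 := by
    simp only [Y]
    rw [← Real.rpow_natCast, ← Real.rpow_mul (by positivity)]
    norm_num
  rw [hY8]
  have hZ2 : ‖sqrtZeta s‖ ^ 2 = ‖riemannZeta s‖ := by rw [← norm_pow, sqrtZeta_sq hs]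
  have hle : ∀ j ≤ 8, Y ^ j ≤ Y ^ 8 := fun j hj => pow_le_pow_right₀ hY1 hj
  -- Square root of the lower bound for `|ζ|`. Each division by `√ζ` below therefore costs a factor
  -- `Y ^ 2`, which gives the exponents 3 and 8 for the two derivatives.
  have hZlow : m ≤ ‖sqrtZeta s‖ * Y ^ 2 := by
    refine le_of_pow_le_pow_left₀ (n := 2) two_ne_zero (by positivity) ?_
    rw [hm2, mul_pow, hZ2]
    exact (hlow s hs hs2 ht).trans_eq (by ring)
  have a0 : ‖sqrtZeta s‖ ≤ √C₀ * Y := by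
    refine le_of_pow_le_pow_left₀ (n := 2) two_ne_zero (by positivity) ?_
    rw [mul_pow, hZ2, Real.sq_sqrt hC₀.le]
    refine (h0 s hs.le hs2 ht).trans ?_
    gcongr
    exact le_self_pow₀ hY1 two_ne_zero
  have a1 : ‖deriv sqrtZeta s‖ ≤ C₁ / m * Y ^ 3 := by
    have e := congrArg norm (two_mul_sqrtZeta_mul_deriv hs)
    rw [norm_mul, norm_mul, Complex.norm_two] at e
    have := h1 s hs.le hs2 ht
    rw [← e] at this
    rw [div_mul_eq_mul_div, le_div_iff₀ hm]
    calc ‖deriv sqrtZeta s‖ * m ≤ ‖deriv sqrtZeta s‖ * (‖sqrtZeta s‖ * Y ^ 2) := by gcongr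
      _ ≤ (2 * ‖sqrtZeta s‖ * ‖deriv sqrtZeta s‖) * Y ^ 2 := by
          have : 0 ≤ ‖sqrtZeta s‖ * ‖deriv sqrtZeta s‖ * Y ^ 2 := by positivity
          linarith
      _ ≤ C₁ * Y * Y ^ 2 := by gcongr
      _ = _ := by ring
  have a2 : ‖deriv (deriv sqrtZeta) s‖ ≤ (C₂ + 2 * (C₁ / m) ^ 2) / m * Y ^ 8 := by
    have e : 2 * sqrtZeta s * deriv (deriv sqrtZeta) s =
        deriv (deriv riemannZeta) s - 2 * deriv sqrtZeta s ^ 2 :=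
      eq_sub_of_add_eq' (two_mul_deriv_sqrtZeta_sq_add hs)
    have e2 := (congrArg norm e).trans_le (norm_sub_le _ _)
    rw [norm_mul, norm_mul, norm_mul, norm_pow, Complex.norm_two] at e2
    have e3 : ‖deriv (deriv riemannZeta) s‖ + 2 * ‖deriv sqrtZeta s‖ ^ 2 ≤
        C₂ * Y ^ 6 + 2 * (C₁ / m * Y ^ 3) ^ 2 := by
      gcongr
      refine (h2 s hs.le hs2 ht).trans ?_
      gcongr
      exact le_self_pow₀ hY1 (by norm_num)
    rw [div_mul_eq_mul_div, le_div_iff₀ hm]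
    calc ‖deriv (deriv sqrtZeta) s‖ * m
        ≤ ‖deriv (deriv sqrtZeta) s‖ * (‖sqrtZeta s‖ * Y ^ 2) := by gcongr
      _ ≤ (2 * ‖sqrtZeta s‖ * ‖deriv (deriv sqrtZeta) s‖) * Y ^ 2 := by
          have : 0 ≤ ‖sqrtZeta s‖ * ‖deriv (deriv sqrtZeta) s‖ * Y ^ 2 := by positivity
          linarith
      _ ≤ (C₂ * Y ^ 6 + 2 * (C₁ / m * Y ^ 3) ^ 2) * Y ^ 2 := by
          gcongr; exact e2.trans e3
      _ = _ := by ring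
  have p0 : 0 ≤ √C₀ := Real.sqrt_nonneg _
  have p1 : 0 ≤ C₁ / m := by positivity
  have p2 : 0 ≤ (C₂ + 2 * (C₁ / m) ^ 2) / m := by positivity
  refine ⟨a0.trans ?_, a1.trans ?_, a2.trans ?_⟩
  · have : Y ≤ Y ^ 8 := le_self_pow₀ hY1 (by norm_num)
    gcongr
    linarith
  · gcongr
    · linarith
    · norm_num
  · gcongr
    linarith

/-- Cauchy's estimate on discs of radius `1/4`, which stay in `Re s ≥ 3/4` when the centre has `Re s
≥ 1`. -/
theorem norm_iteratedDeriv_le_of_bounded_halfPlane {Φ : ℂ → ℂ} {B : ℝ}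
    (hΦ : DifferentiableOn ℂ Φ {s : ℂ | 1 / 2 < s.re}) (hB : ∀ s : ℂ, 3 / 4 ≤ s.re → ‖Φ s‖ ≤ B)
    (n : ℕ) {s : ℂ} (hs : 1 ≤ s.re) :
    ‖iteratedDeriv n Φ s‖ ≤ n.factorial * B / (1 / 4) ^ n := by
  have hball : ∀ z ∈ Metric.closedBall s (1 / 4), 3 / 4 ≤ z.re := by
    intro z hz
    rw [Metric.mem_closedBall, Complex.dist_eq] at hz
    have h1 := (Complex.abs_re_le_norm (z - s)).trans hz
    rw [Complex.sub_re, abs_le] at h1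
    linarith
  refine Complex.norm_iteratedDeriv_le_of_forall_mem_sphere_norm_le n (by norm_num)
    ((hΦ.mono fun z hz => ?_).diffContOnCl_ball subset_rfl)
    fun z hz => hB z (hball z (Metric.sphere_subset_closedBall hz))
  have := hball z hz
  show 1 / 2 < z.re
  linarith

theorem exists_norm_deriv_deriv_sqrtZeta_mul_le {Φ : ℂ → ℂ} {B : ℝ}
    (hΦ : DifferentiableOn ℂ Φ {s : ℂ | 1 / 2 < s.re}) (hB : ∀ s : ℂ, 3 / 4 ≤ s.re → ‖Φ s‖ ≤ B)
    {ρ : ℝ} (hρ : 0 < ρ) :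
    ∃ C : ℝ, 0 ≤ C ∧ ∀ s : ℂ, 1 < s.re → s.re ≤ 2 → ρ ≤ |s.im| →
      ‖deriv (deriv fun z => sqrtZeta z * Φ z) s‖ ≤ C * (1 + |s.im|) ^ (1 / 4 : ℝ) := by
  obtain ⟨M, hM, hZ⟩ := exists_norm_deriv_sqrtZeta_le hρ
  have hB0 : 0 ≤ B := (norm_nonneg _).trans (hB 1 (by norm_num))
  refine ⟨M * B + 2 * (M * (4 * B)) + M * (32 * B), by positivity, fun s hs hs2 ht => ?_⟩
  obtain ⟨z0, z1, z2⟩ := hZ s hs hs2 ht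
  have f0 := norm_iteratedDeriv_le_of_bounded_halfPlane hΦ hB 0 hs.le
  have f1 := norm_iteratedDeriv_le_of_bounded_halfPlane hΦ hB 1 hs.le
  have f2 := norm_iteratedDeriv_le_of_bounded_halfPlane hΦ hB 2 hs.le
  simp only [iteratedDeriv_zero, iteratedDeriv_one, iteratedDeriv_succ (n := 1)] at f0 f1 f2
  norm_num at f0 f1 f2
  rw [deriv_deriv_mul (isOpen_re_gt 1) differentiableOn_sqrtZeta (hΦ.mono fun z hz => ?_) hs]
  · refine norm_add₃_le.trans ?_
    rw [norm_mul, norm_mul, norm_mul, norm_mul, Complex.norm_two]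
    set T := (1 + |s.im|) ^ (1 / 4 : ℝ)
    have hT : 0 ≤ T := by positivity
    calc _ ≤ M * T * B + 2 * (M * T * (4 * B)) + M * T * (32 * B) := by
          gcongr <;> linarith
      _ = _ := by ring
  · have : (1 : ℝ) < z.re := hz
    show 1 / 2 < z.re
    linarith

/-! ### The singularity at `s = 1` -/

/-- Both sides are continuous square roots of `ζ` on a convex set where `ζ` does not vanish, so they
agree up to one global sign. Positivity at a real point fixes the sign. This isolates the factor
`(s-1)^(-1/2)`. -/
theorem sqrtZeta_eq_near_one :
    ∃ ρ : ℝ, 0 < ρ ∧ ρ ≤ 1 / 2 ∧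
      (∀ s ∈ Metric.ball (1 : ℂ) ρ, riemannZeta₁ s ∈ Complex.slitPlane) ∧
      ∀ s ∈ Metric.ball (1 : ℂ) ρ, 1 < s.re →
        sqrtZeta s = (s - 1) ^ ((-(1 / 2) : ℝ) : ℂ) * riemannZeta₁ s ^ ((1 / 2 : ℝ) : ℂ) := by
  have hev : ∀ᶠ s in nhds (1 : ℂ), riemannZeta₁ s ∈ Complex.slitPlane := by
    refine differentiable_riemannZeta₁.continuous.continuousAt.eventually_mem
      (Complex.isOpen_slitPlane.mem_nhds ?_)
    rw [riemannZeta₁_one]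
    exact Complex.one_mem_slitPlane
  obtain ⟨r, hr, hball⟩ := Metric.eventually_nhds_iff_ball.mp hev
  refine ⟨min r (1 / 2), by positivity, min_le_right _ _,
    fun s hs => hball s (Metric.ball_subset_ball (min_le_left _ _) hs), ?_⟩
  set ρ := min r (1 / 2)
  have hρ : 0 < ρ := by positivity
  set U : Set ℂ := Metric.ball (1 : ℂ) ρ ∩ {s | 1 < s.re}
  have hUc : Convex ℝ U := (convex_ball _ _).inter (convex_halfSpace_re_gt 1)
  have hslit : ∀ s ∈ U, riemannZeta₁ s ∈ Complex.slitPlane :=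
    fun s hs => hball s (Metric.ball_subset_ball (min_le_left _ _) hs.1)
  have hslit' : ∀ s ∈ U, s - 1 ∈ Complex.slitPlane := fun s hs => by
    left
    have : 1 < s.re := hs.2
    simpa using this
  set g : ℂ → ℂ :=
    fun s => (s - 1) ^ ((-(1 / 2) : ℝ) : ℂ) * riemannZeta₁ s ^ ((1 / 2 : ℝ) : ℂ)
  have hg0 : ∀ s ∈ U, g s ≠ 0 := fun s hs => by
    refine mul_ne_zero ?_ ?_
    · rw [Ne, Complex.cpow_eq_zero_iff]
      exact fun h => Complex.slitPlane_ne_zero (hslit' s hs) h.1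
    · rw [Ne, Complex.cpow_eq_zero_iff]
      exact fun h => Complex.slitPlane_ne_zero (hslit s hs) h.1
  have hgc : ContinuousOn g U := by
    refine ContinuousOn.mul ?_ ?_
    · exact ContinuousOn.cpow (by fun_prop) continuousOn_const hslit'
    · exact ContinuousOn.cpow differentiable_riemannZeta₁.continuous.continuousOn
        continuousOn_const hslit
  have hg2 : ∀ s ∈ U, g s ^ 2 = riemannZeta s := fun s hs => by
    have hs1 : s ≠ 1 := by
      rintro rfl
      simpa using hs.2
    simp only [g, mul_pow]
    rw [← Complex.cpow_nat_mul, ← Complex.cpow_nat_mul, riemannZeta_eq_inv_sub_mul hs1,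
      ← Complex.cpow_neg_one]
    congr 2
    · push_cast; ring
    · have : (((2 : ℕ) : ℂ) * ((1 / 2 : ℝ) : ℂ)) = 1 := by push_cast; ring
      rw [this, Complex.cpow_one]
  set σ : ℝ := 1 + ρ / 2
  have hσ : 1 < σ := by simp only [σ]; linarith
  have hσU : (σ : ℂ) ∈ U := by
    refine ⟨?_, by simpa using hσ⟩
    rw [Metric.mem_ball, Complex.dist_eq]
    have : (σ : ℂ) - 1 = ((ρ / 2 : ℝ) : ℂ) := by simp [σ]
    rw [this, Complex.norm_real, Real.norm_of_nonneg (by positivity)]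
    linarith
  have hσeq : sqrtZeta σ = g σ := by
    obtain ⟨y, hy, hyeq⟩ := sqrtZeta_ofReal hσ
    have hz1 : riemannZeta₁ σ = (((σ - 1) * y ^ 2 : ℝ) : ℂ) := by
      have hs1 : (σ : ℂ) ≠ 1 := by exact_mod_cast hσ.ne'
      have := riemannZeta_eq_inv_sub_mul hs1
      rw [← sqrtZeta_sq (by simpa using hσ), hyeq] at this
      rw [← mul_inv_cancel_left₀ (sub_ne_zero.mpr hs1) (riemannZeta₁ σ), ← this]
      push_cast; ring
    have hσ0 : 0 < σ - 1 := by linarith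
    have : g σ = (((σ - 1) ^ (-(1 / 2) : ℝ) * ((σ - 1) * y ^ 2) ^ (1 / 2 : ℝ) : ℝ) : ℂ) := by
      simp only [g]
      rw [hz1, ← Complex.ofReal_one, ← Complex.ofReal_sub, ← Complex.ofReal_cpow hσ0.le,
        ← Complex.ofReal_cpow (by positivity)]
      push_cast; ring
    rw [this, hyeq, Real.mul_rpow hσ0.le (by positivity), ← mul_assoc, ← Real.rpow_add hσ0,
      ← Real.rpow_natCast y 2, ← Real.rpow_mul hy.le]
    norm_num
  have := hUc.isPreconnected.eq_of_sq_eq (f := sqrtZeta) (g := g)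
    (differentiableOn_sqrtZeta.continuousOn.mono fun s hs => hs.2) hgc
    (fun s hs => by
      rw [Pi.pow_apply, Pi.pow_apply, hg2 s hs, sqrtZeta_sq hs.2]) (fun hs => hg0 _ hs) hσU hσeq
  exact fun s hs hs1 => this ⟨hs, hs1⟩

theorem hasDerivAt_sub_one_cpow {s : ℂ} (hs : 1 < s.re) (a : ℝ) :
    HasDerivAt (fun z : ℂ => (z - 1) ^ (a : ℂ)) (a * (s - 1) ^ ((a - 1 : ℝ) : ℂ)) s := by
  have h : s - 1 ∈ Complex.slitPlane := by left; simpa using hs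
  refine (((hasDerivAt_id s).sub_const 1).cpow_const (c := (a : ℂ)) h).congr_deriv ?_
  simp

/-- Write the product as `(s-1)^(-1/2) H(s)` with `H` holomorphic at 1 and `H(1) = Φ(1)`. The
leading term of the second derivative has coefficient `(-1/2)(-3/2) = 3/4`, and `3/8 * s * (s + 1)`
takes this value at `s = 1`. -/
theorem exists_norm_deriv_deriv_sub_le_near_one {Φ : ℂ → ℂ}
    (hΦ : DifferentiableOn ℂ Φ {s : ℂ | 1 / 2 < s.re}) :
    ∃ ρ C : ℝ, 0 < ρ ∧ ρ ≤ 1 / 2 ∧ 0 ≤ C ∧ ∀ s : ℂ, 1 < s.re → ‖s - 1‖ ≤ ρ →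
      ‖deriv (deriv fun z => sqrtZeta z * Φ z) s -
          3 / 8 * Φ 1 * (s * (s + 1)) * (s - 1) ^ ((-(5 / 2) : ℝ) : ℂ)‖ ≤
        C * ‖s - 1‖ ^ (-(3 / 2) : ℝ) := by
  obtain ⟨r, hr, hr2, hslit, hZ⟩ := sqrtZeta_eq_near_one
  set V : Set ℂ := Metric.ball 1 r
  have hV : IsOpen V := Metric.isOpen_ball
  set H : ℂ → ℂ := fun s => riemannZeta₁ s ^ ((1 / 2 : ℝ) : ℂ) * Φ s
  have hVre : ∀ s ∈ V, 1 / 2 < s.re := fun s hs => by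
    have h1 : ‖s - 1‖ < r := by simpa [V, Complex.dist_eq] using hs
    have h2 := (Complex.abs_re_le_norm (s - 1)).trans_lt h1
    rw [Complex.sub_re, abs_lt] at h2
    have : (1 : ℂ).re = 1 := rfl
    linarith
  have hH : DifferentiableOn ℂ H V :=
    DifferentiableOn.mul (fun s hs =>
      (differentiable_riemannZeta₁.differentiableAt.cpow_const (hslit s hs)).differentiableWithinAt)
      (hΦ.mono hVre)
  have hH' : DifferentiableOn ℂ (deriv H) V := hH.deriv hV
  have hH'' : DifferentiableOn ℂ (deriv (deriv H)) V := hH'.deriv hV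
  -- This vanishes at 1, so it is `O(|s-1|)` and lowers the order of the singularity by one.
  set G : ℂ → ℂ := fun s => H s - Φ 1 * (s * (s + 1) / 2)
  have hG : DifferentiableOn ℂ G V := hH.sub (by fun_prop)
  have hG1 : G 1 = 0 := by simp [G, H, riemannZeta₁_one]
  set K : Set ℂ := Metric.closedBall 1 (r / 2)
  have hKV : K ⊆ V := Metric.closedBall_subset_ball (by linarith)
  have hK : IsCompact K := isCompact_closedBall _ _
  obtain ⟨b₀, hb₀⟩ := hK.exists_bound_of_continuousOn ((hG.deriv hV).continuousOn.mono hKV)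
  obtain ⟨b₁, hb₁⟩ := hK.exists_bound_of_continuousOn (hH'.continuousOn.mono hKV)
  obtain ⟨b₂, hb₂⟩ := hK.exists_bound_of_continuousOn (hH''.continuousOn.mono hKV)
  have h1K : (1 : ℂ) ∈ K := by simp [K]; positivity
  have hb₀' := (norm_nonneg _).trans (hb₀ 1 h1K)
  have hb₁' := (norm_nonneg _).trans (hb₁ 1 h1K)
  have hb₂' := (norm_nonneg _).trans (hb₂ 1 h1K)
  refine ⟨r / 2, 3 / 4 * b₀ + b₁ + b₂, by positivity, by linarith, by positivity,
    fun s hs hsr => ?_⟩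
  have hsK : s ∈ K := by simpa [K, Complex.dist_eq] using hsr
  set w := ‖s - 1‖
  have hw : 0 < w := norm_pos_iff.mpr (sub_ne_zero.mpr (by rintro rfl; simp at hs))
  have hw1 : w ≤ 1 := by linarith
  have hGs : ‖G s‖ ≤ b₀ * w := by
    have := (convex_closedBall (1 : ℂ) (r / 2)).norm_image_sub_le_of_norm_deriv_le (𝕜 := ℂ)
      (f := G) (fun z hz => (hG z (hKV hz)).differentiableAt (hV.mem_nhds (hKV hz))) hb₀ h1K hsK
    rwa [hG1, sub_zero] at this
  set U : Set ℂ := V ∩ {s | 1 < s.re}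
  have hU : IsOpen U := hV.inter (isOpen_re_gt 1)
  have hsU : s ∈ U := ⟨hKV hsK, hs⟩
  have hp1 : ∀ z : ℂ, 1 < z.re → deriv (fun z : ℂ => (z - 1) ^ ((-(1 / 2) : ℝ) : ℂ)) z =
      ((-(1 / 2) : ℝ) : ℂ) * (z - 1) ^ ((-(3 / 2) : ℝ) : ℂ) := fun z hz => by
    rw [(hasDerivAt_sub_one_cpow hz _).deriv]; norm_num
  have hp2 : deriv (deriv fun z : ℂ => (z - 1) ^ ((-(1 / 2) : ℝ) : ℂ)) s =
      3 / 4 * (s - 1) ^ ((-(5 / 2) : ℝ) : ℂ) := by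
    have : deriv (fun z : ℂ => (z - 1) ^ ((-(1 / 2) : ℝ) : ℂ)) =ᶠ[nhds s]
        fun z => ((-(1 / 2) : ℝ) : ℂ) * (z - 1) ^ ((-(3 / 2) : ℝ) : ℂ) := by
      filter_upwards [(isOpen_re_gt 1).mem_nhds hs] with z hz using hp1 z hz
    rw [this.deriv_eq, ((hasDerivAt_sub_one_cpow hs _).const_mul _).deriv]
    norm_num
    ring
  have hev : (fun z => sqrtZeta z * Φ z) =ᶠ[nhds s]
      fun z => (z - 1) ^ ((-(1 / 2) : ℝ) : ℂ) * H z := by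
    filter_upwards [hU.mem_nhds hsU] with z hz
    rw [hZ z hz.1 hz.2]
    simp only [H]
    ring
  rw [hev.deriv.deriv_eq, deriv_deriv_mul hU (f := fun z : ℂ => (z - 1) ^ ((-(1 / 2) : ℝ) : ℂ))
    (fun z hz => (hasDerivAt_sub_one_cpow hz.2 _).differentiableAt.differentiableWithinAt)
    (hH.mono Set.inter_subset_left) hsU, hp2, hp1 s hs]
  have hsplit : 3 / 4 * (s - 1) ^ ((-(5 / 2) : ℝ) : ℂ) * H s +
      2 * (((-(1 / 2) : ℝ) : ℂ) * (s - 1) ^ ((-(3 / 2) : ℝ) : ℂ) * deriv H s) +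
      (s - 1) ^ ((-(1 / 2) : ℝ) : ℂ) * deriv (deriv H) s -
      3 / 8 * Φ 1 * (s * (s + 1)) * (s - 1) ^ ((-(5 / 2) : ℝ) : ℂ) =
      3 / 4 * ((s - 1) ^ ((-(5 / 2) : ℝ) : ℂ) * G s) +
      -((s - 1) ^ ((-(3 / 2) : ℝ) : ℂ) * deriv H s) +
      (s - 1) ^ ((-(1 / 2) : ℝ) : ℂ) * deriv (deriv H) s := by
    simp only [G]
    push_cast
    ring
  rw [hsplit]
  refine norm_add₃_le.trans ?_
  rw [norm_neg, norm_mul, norm_mul, norm_mul, norm_mul, Complex.norm_cpow_real,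
    Complex.norm_cpow_real, Complex.norm_cpow_real]
  have e1 : w ^ (-(5 / 2) : ℝ) * w = w ^ (-(3 / 2) : ℝ) := by
    rw [← Real.rpow_add_one hw.ne']; norm_num
  have e2 : w ^ (-(1 / 2) : ℝ) ≤ w ^ (-(3 / 2) : ℝ) :=
    Real.rpow_le_rpow_of_exponent_ge hw hw1 (by norm_num)
  have e3 : ‖(3 / 4 : ℂ)‖ = 3 / 4 := by norm_num
  rw [e3]
  calc 3 / 4 * (w ^ (-(5 / 2) : ℝ) * ‖G s‖) + w ^ (-(3 / 2) : ℝ) * ‖deriv H s‖ +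
        w ^ (-(1 / 2) : ℝ) * ‖deriv (deriv H) s‖
      ≤ 3 / 4 * (w ^ (-(5 / 2) : ℝ) * (b₀ * w)) + w ^ (-(3 / 2) : ℝ) * b₁ +
        w ^ (-(3 / 2) : ℝ) * b₂ := by
        gcongr
        · exact hb₁ s hsK
        · exact hb₂ s hsK
    _ = (3 / 4 * b₀) * (w ^ (-(5 / 2) : ℝ) * w) + w ^ (-(3 / 2) : ℝ) * b₁ +
        w ^ (-(3 / 2) : ℝ) * b₂ := by ring
    _ = _ := by rw [e1]; ring

theorem exists_norm_deriv_deriv_sub_le {Φ : ℂ → ℂ} {B : ℝ}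
    (hΦ : DifferentiableOn ℂ Φ {s : ℂ | 1 / 2 < s.re}) (hB : ∀ s : ℂ, 3 / 4 ≤ s.re → ‖Φ s‖ ≤ B) :
    ∃ δ C : ℝ, 0 < δ ∧ δ ≤ 1 ∧ 0 ≤ C ∧ ∀ s : ℂ, 1 < s.re → s.re ≤ 1 + δ →
      ‖deriv (deriv fun z => sqrtZeta z * Φ z) s -
          3 / 8 * Φ 1 * (s * (s + 1)) * (s - 1) ^ ((-(5 / 2) : ℝ) : ℂ)‖ ≤
        C * ((s.re - 1 + |s.im|) ^ (-(3 / 2) : ℝ) + (1 + |s.im|) ^ (1 / 4 : ℝ)) := by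
  obtain ⟨ρ, C₁, hρ, hρ1, hC₁, hnear⟩ := exists_norm_deriv_deriv_sub_le_near_one hΦ
  obtain ⟨C₂, hC₂, hfar⟩ := exists_norm_deriv_deriv_sqrtZeta_mul_le hΦ hB (half_pos hρ)
  set D : ℝ := 3 / 8 * ‖Φ 1‖ * ((1 + 2 / ρ) * (1 + 4 / ρ)) * (ρ / 2) ^ (-(1 / 2) : ℝ)
  have hD : 0 ≤ D := by positivity
  refine ⟨ρ / 2, 4 * C₁ + C₂ + D, by positivity, by linarith, by positivity,
    fun s hs hs2 => ?_⟩
  set X := (s.re - 1 + |s.im|) ^ (-(3 / 2) : ℝ)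
  set T := (1 + |s.im|) ^ (1 / 4 : ℝ)
  have hX : 0 ≤ X := Real.rpow_nonneg (by linarith [abs_nonneg s.im]) _
  have hT : 1 ≤ T := Real.one_le_rpow (by simp) (by norm_num)
  set w := ‖s - 1‖
  have hwre : s.re - 1 ≤ w := by
    have := Complex.re_le_norm (s - 1)
    simpa using this
  have hwim : |s.im| ≤ w := by simpa using Complex.abs_im_le_norm (s - 1)
  have hw : 0 < w := by linarith
  -- For small imaginary part the local expansion applies. Otherwise both terms are estimated
  -- separately: the singular one is bounded there, because `s (s+1) (s-1)^(-5/2)` is of order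
  -- `|s-1|^(-1/2)`.
  rcases le_total |s.im| (ρ / 2) with ht | ht
  · have hwle : w ≤ ρ := by
      have := Complex.norm_le_abs_re_add_abs_im (s - 1)
      simp only [Complex.sub_re, Complex.one_re, Complex.sub_im, Complex.one_im, sub_zero] at this
      rw [abs_of_pos (by linarith : 0 < s.re - 1)] at this
      linarith
    refine (hnear s hs hwle).trans ?_
    have h1 : w ^ (-(3 / 2) : ℝ) ≤ 4 * X := by
      have hpos : 0 < s.re - 1 + |s.im| := by linarith [abs_nonneg s.im]
      calc w ^ (-(3 / 2) : ℝ) ≤ (2⁻¹ * (s.re - 1 + |s.im|)) ^ (-(3 / 2) : ℝ) :=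
            Real.rpow_le_rpow_of_nonpos (by positivity) (by linarith) (by norm_num)
        _ = 2⁻¹ ^ (-(3 / 2) : ℝ) * X := Real.mul_rpow (by norm_num) hpos.le
        _ ≤ 4 * X := by
            gcongr
            rw [Real.inv_rpow (by norm_num), ← Real.rpow_neg (by norm_num)]
            calc (2 : ℝ) ^ (-(-(3 / 2)) : ℝ) ≤ 2 ^ (2 : ℝ) :=
                  Real.rpow_le_rpow_of_exponent_le (by norm_num) (by norm_num)
              _ = 4 := by norm_num
    calc C₁ * w ^ (-(3 / 2) : ℝ) ≤ C₁ * (4 * X) := by gcongr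
      _ = 4 * C₁ * X + 0 := by ring
      _ ≤ (4 * C₁ + C₂ + D) * X + (4 * C₁ + C₂ + D) * T := by
          gcongr
          · linarith
          · positivity
      _ = _ := by ring
  · have hwρ : ρ / 2 ≤ w := ht.trans hwim
    have hF := hfar s hs (by linarith) ht
    have n1 : ‖s‖ ≤ (1 + 2 / ρ) * w := by
      have h1 : ‖s‖ ≤ w + 1 := by
        have := norm_add_le (s - 1) 1
        simpa using this
      have h2 : 1 ≤ 2 / ρ * w := by
        rw [div_mul_eq_mul_div, le_div_iff₀ hρ]; linarith
      linarith
    have n2 : ‖s + 1‖ ≤ (1 + 4 / ρ) * w := by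
      have h1 : ‖s + 1‖ ≤ w + 2 := by
        have := norm_add_le (s - 1) 2
        have e : s - 1 + 2 = s + 1 := by ring
        rw [e] at this
        simpa using this
      have h2 : 2 ≤ 4 / ρ * w := by
        rw [div_mul_eq_mul_div, le_div_iff₀ hρ]; linarith
      linarith
    have hM : ‖3 / 8 * Φ 1 * (s * (s + 1)) * (s - 1) ^ ((-(5 / 2) : ℝ) : ℂ)‖ ≤ D := by
      rw [norm_mul, norm_mul, norm_mul, norm_mul s, Complex.norm_cpow_real]
      have e3 : ‖(3 / 8 : ℂ)‖ = 3 / 8 := by norm_num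
      rw [e3]
      calc 3 / 8 * ‖Φ 1‖ * (‖s‖ * ‖s + 1‖) * w ^ (-(5 / 2) : ℝ)
          ≤ 3 / 8 * ‖Φ 1‖ * ((1 + 2 / ρ) * w * ((1 + 4 / ρ) * w)) * w ^ (-(5 / 2) : ℝ) := by
            gcongr
        _ = 3 / 8 * ‖Φ 1‖ * ((1 + 2 / ρ) * (1 + 4 / ρ)) * (w ^ (-(5 / 2) : ℝ) * w * w) := by
            ring
        _ = 3 / 8 * ‖Φ 1‖ * ((1 + 2 / ρ) * (1 + 4 / ρ)) * w ^ (-(1 / 2) : ℝ) := by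
            rw [← Real.rpow_add_one hw.ne', ← Real.rpow_add_one hw.ne']; norm_num
        _ ≤ D := by
            simp only [D]
            gcongr ?_ * ?_
            exact Real.rpow_le_rpow_of_nonpos (by positivity) hwρ (by norm_num)
    refine (norm_sub_le _ _).trans ((add_le_add hF hM).trans ?_)
    have hDT : D ≤ D * T := le_mul_of_one_le_right hD hT
    calc C₂ * T + D ≤ 0 + (0 + C₂ + D) * T := by linarith
      _ ≤ (4 * C₁ + C₂ + D) * X + (4 * C₁ + C₂ + D) * T := by
          gcongr
          · positivity
          · linarith
      _ = _ := by ring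

/-! ### Laplace transform of a power and its inversion on a vertical line -/

open MeasureTheory in
theorem integrable_rpow_mul_cexp {p : ℝ} (hp : -1 < p) {r : ℂ} (hr : 0 < r.re) :
    IntegrableOn (fun t : ℝ => ((t ^ p : ℝ) : ℂ) * Complex.exp (-(r * t))) (Set.Ioi 0) := by
  have h := integrableOn_rpow_mul_exp_neg_mul_rpow hp one_pos hr
  refine Integrable.mono' h (ContinuousOn.aestronglyMeasurable ?_ measurableSet_Ioi) ?_
  · refine ContinuousOn.mul (Complex.continuous_ofReal.comp_continuousOn ?_) (by fun_prop)
    exact ContinuousOn.rpow_const continuousOn_id fun x hx => Or.inl (ne_of_gt hx)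
  · refine (ae_restrict_iff' measurableSet_Ioi).mpr (ae_of_all _ fun t ht => ?_)
    have ht : 0 < t := ht
    rw [norm_mul, Complex.norm_real, Real.norm_of_nonneg (by positivity), Complex.norm_exp]
    simp

open MeasureTheory in
theorem differentiableOn_integral_rpow_mul_cexp {p : ℝ} (hp : -1 < p) :
    DifferentiableOn ℂ (fun r : ℂ => ∫ t in Set.Ioi (0 : ℝ),
      ((t ^ p : ℝ) : ℂ) * Complex.exp (-(r * t))) {r | 0 < r.re} := by
  intro r₀ hr₀
  have hr₀ : 0 < r₀.re := hr₀
  have hnhds : {r : ℂ | r₀.re / 2 < r.re} ∈ nhds r₀ :=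
    (isOpen_re_gt _).mem_nhds (by show r₀.re / 2 < r₀.re; linarith)
  have h := hasDerivAt_integral_of_dominated_loc_of_deriv_le
    (μ := volume.restrict (Set.Ioi (0 : ℝ)))
    (F := fun (r : ℂ) (t : ℝ) => ((t ^ p : ℝ) : ℂ) * Complex.exp (-(r * t)))
    (F' := fun (r : ℂ) (t : ℝ) => -((t ^ (p + 1) : ℝ) : ℂ) * Complex.exp (-(r * t)))
    (bound := fun t : ℝ => t ^ (p + 1) * Real.exp (-(r₀.re / 2) * t ^ (1 : ℝ)))
    hnhds ?_ (integrable_rpow_mul_cexp hp hr₀) ?_ ?_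
    (integrableOn_rpow_mul_exp_neg_mul_rpow (by linarith) one_pos (by linarith)) ?_
  · exact h.2.differentiableAt.differentiableWithinAt
  · filter_upwards [(isOpen_re_gt 0).mem_nhds hr₀] with r hr
    exact (integrable_rpow_mul_cexp hp hr).aestronglyMeasurable
  · have := (integrable_rpow_mul_cexp (show -1 < p + 1 by linarith) hr₀).aestronglyMeasurable.neg
    exact this.congr (ae_of_all _ fun t => by simp)
  · refine (ae_restrict_iff' measurableSet_Ioi).mpr (ae_of_all _ fun t ht r hr => ?_)
    have ht : 0 < t := ht
    have hr : r₀.re / 2 < r.re := hr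
    rw [norm_mul, norm_neg, Complex.norm_real, Real.norm_of_nonneg (by positivity),
      Complex.norm_exp, Real.rpow_one]
    gcongr
    simp only [Complex.neg_re, Complex.re_mul_ofReal]
    nlinarith
  · refine (ae_restrict_iff' measurableSet_Ioi).mpr (ae_of_all _ fun t ht r _ => ?_)
    have ht : 0 < t := ht
    have h1 : HasDerivAt (fun r : ℂ => -(r * t)) (-(t : ℂ)) r := by
      simpa using ((hasDerivAt_id r).mul_const (t : ℂ)).fun_neg
    refine (h1.cexp.const_mul _).congr_deriv ?_
    rw [Real.rpow_add_one ht.ne']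
    push_cast
    ring

/-- The Laplace transform of `t ^ (a - 1)` in the right half-plane. -/
theorem integral_rpow_mul_cexp {a : ℝ} (ha : 0 < a) {r : ℂ} (hr : 0 < r.re) :
    ∫ t in Set.Ioi (0 : ℝ), ((t ^ (a - 1) : ℝ) : ℂ) * Complex.exp (-(r * t)) =
      r ^ ((-a : ℝ) : ℂ) * Real.Gamma a := by
  have hd := differentiableOn_integral_rpow_mul_cexp (show -1 < a - 1 by linarith)
  have hd2 : DifferentiableOn ℂ (fun r : ℂ => r ^ ((-a : ℝ) : ℂ) * (Real.Gamma a : ℂ))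
      {r | 0 < r.re} := fun z hz =>
    ((differentiableAt_id.cpow_const (Or.inl hz)).mul_const _).differentiableWithinAt
  have hreal : ∀ x : ℝ, 0 < x →
      ∫ t in Set.Ioi (0 : ℝ), ((t ^ (a - 1) : ℝ) : ℂ) * Complex.exp (-((x : ℂ) * t)) =
      (x : ℂ) ^ ((-a : ℝ) : ℂ) * Real.Gamma a := fun x hx => by
    have h := Complex.integral_cpow_mul_exp_neg_mul_Ioi (a := (a : ℂ)) (by simpa using ha) hx
    rw [Complex.Gamma_ofReal] at h
    rw [← Complex.ofReal_cpow hx.le, Real.rpow_neg hx.le, ← Real.inv_rpow hx.le,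
      Complex.ofReal_cpow (by positivity)]
    rw [one_div, ← Complex.ofReal_inv] at h
    rw [← h]
    refine MeasureTheory.setIntegral_congr_fun measurableSet_Ioi fun t ht => ?_
    have ht : 0 < t := ht
    rw [Complex.ofReal_cpow ht.le]
    push_cast
    rfl
  -- The formula is known for real `r > 0`; the points `1 + 1/(n+1)` accumulate at 1, so the
  -- identity theorem extends it.
  refine AnalyticOnNhd.eqOn_of_preconnected_of_frequently_eq (z₀ := 1)
    (hd.analyticOnNhd (isOpen_re_gt 0)) (hd2.analyticOnNhd (isOpen_re_gt 0))
    (convex_halfSpace_re_gt 0).isPreconnected (by simp) ?_ hr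
  have htend : Tendsto (fun n : ℕ => ((1 + 1 / ((n : ℝ) + 1) : ℝ) : ℂ)) atTop
      (nhdsWithin 1 {1}ᶜ) := by
    refine tendsto_nhdsWithin_iff.mpr ⟨?_, Eventually.of_forall fun n => ?_⟩
    · have h1 : Tendsto (fun n : ℕ => 1 + 1 / ((n : ℝ) + 1)) atTop (nhds 1) := by
        simpa using tendsto_one_div_add_atTop_nhds_zero_nat.const_add (1 : ℝ)
      have h2 := (Complex.continuous_ofReal.tendsto 1).comp h1
      rwa [Complex.ofReal_one] at h2
    · have : (0 : ℝ) < 1 / ((n : ℝ) + 1) := by positivity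
      have h2 : (1 + 1 / ((n : ℝ) + 1) : ℝ) ≠ 1 := by linarith
      rw [Set.mem_compl_singleton_iff]
      exact fun h => h2 (Complex.ofReal_injective (by rw [h, Complex.ofReal_one]))
  exact htend.frequently (Frequently.of_forall fun n => hreal _ (by positivity))

theorem integrable_add_abs_rpow {b p : ℝ} (hb : 0 < b) (hp : 1 < p) :
    MeasureTheory.Integrable fun t : ℝ => (b + |t|) ^ (-p) := by
  have h := ((integrable_one_add_norm (E := ℝ) (μ := MeasureTheory.volume) (r := p)
    (by simpa using hp)).comp_div hb.ne').const_mul (b ^ (-p))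
  refine h.congr (Eventually.of_forall fun t => ?_)
  simp only
  rw [← Real.mul_rpow hb.le (by positivity), Real.norm_eq_abs, abs_div, abs_of_pos hb]
  congr 1
  field_simp

/-- Scaling `t` by `b`. With `b = 1/L` and `p = 3/2` this is the source of the factor `√L` in the
error term. -/
theorem integral_add_abs_rpow {b : ℝ} (hb : 0 < b) (p : ℝ) :
    ∫ t : ℝ, (b + |t|) ^ (-p) = b ^ (1 - p) * ∫ t : ℝ, (1 + |t|) ^ (-p) := by
  have h := MeasureTheory.Measure.integral_comp_div (fun t : ℝ => (1 + |t|) ^ (-p)) b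
  have e : ∀ t : ℝ, (b + |t|) ^ (-p) = b ^ (-p) * (1 + |t / b|) ^ (-p) := fun t => by
    rw [← Real.mul_rpow hb.le (by positivity), abs_div, abs_of_pos hb]
    congr 1
    field_simp
  simp_rw [e]
  rw [MeasureTheory.integral_const_mul, h, abs_of_pos hb, smul_eq_mul, ← mul_assoc,
    ← Real.rpow_add_one hb.ne']
  congr 2
  ring

theorem norm_ofReal_add_mul_I_ge {b : ℝ} (hb : 0 ≤ b) (t : ℝ) :
    (b + |t|) / 2 ≤ ‖(b : ℂ) + t * Complex.I‖ := by
  have h1 := Complex.abs_re_le_norm ((b : ℂ) + t * Complex.I)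
  have h2 := Complex.abs_im_le_norm ((b : ℂ) + t * Complex.I)
  simp only [Complex.add_re, Complex.ofReal_re, Complex.mul_re, Complex.I_re, Complex.ofReal_im,
    Complex.I_im, Complex.add_im, Complex.mul_im] at h1 h2
  norm_num at h1 h2
  rw [abs_of_nonneg hb] at h1
  linarith

theorem continuous_vertical_cpow {b : ℝ} (hb : 0 < b) (p : ℂ) :
    Continuous fun t : ℝ => ((b : ℂ) + t * Complex.I) ^ p :=
  Continuous.cpow (by fun_prop) continuous_const fun t => by left; simpa using hb

theorem integrable_vertical_cpow {b p : ℝ} (hb : 0 < b) (hp : 1 < p) :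
    MeasureTheory.Integrable fun t : ℝ => ((b : ℂ) + t * Complex.I) ^ ((-p : ℝ) : ℂ) := by
  refine ((integrable_add_abs_rpow hb hp).const_mul (2⁻¹ ^ (-p))).mono'
    (continuous_vertical_cpow hb _).aestronglyMeasurable (Eventually.of_forall fun t => ?_)
  rw [Complex.norm_cpow_real, ← Real.mul_rpow (by norm_num) (by positivity)]
  refine Real.rpow_le_rpow_of_nonpos (by positivity) ?_ (by linarith)
  have := norm_ofReal_add_mul_I_ge hb.le t
  linarith

open MeasureTheory FourierTransform in
/-- Inversion of the Laplace transform of `v ^ (p - 1)`. -/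
theorem integral_vertical_cpow_mul_cexp {b p : ℝ} (hb : 0 < b) (hp : 1 < p) {L : ℝ} (hL : 0 < L) :
    ∫ t : ℝ, ((b : ℂ) + t * Complex.I) ^ ((-p : ℝ) : ℂ) *
        Complex.exp (((b : ℂ) + t * Complex.I) * L) =
      ((2 * Real.pi / Real.Gamma p * L ^ (p - 1) : ℝ) : ℂ) := by
  -- The damped power `v^(p-1) exp(-bv)` on the half-line: its Fourier transform is the Laplace
  -- transform on `Re s = b`, integrable because `p > 1`, so Fourier inversion applies at `L`.
  set f : ℝ → ℂ := (Set.Ioi (0 : ℝ)).indicator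
    fun v => ((v ^ (p - 1) : ℝ) : ℂ) * Complex.exp (-((b : ℂ) * v))
  have hf : Integrable f :=
    (integrable_indicator_iff measurableSet_Ioi).mpr
      (integrable_rpow_mul_cexp (by linarith) (by simpa using hb))
  have hF : 𝓕 f = fun ξ : ℝ => ((b : ℂ) + ((2 * Real.pi * ξ : ℝ) : ℂ) * Complex.I) ^
      ((-p : ℝ) : ℂ) * Real.Gamma p := by
    ext ξ
    rw [Real.fourier_real_eq_integral_exp_smul, ← integral_rpow_mul_cexp (by linarith)
      (by simpa using hb), ← integral_indicator measurableSet_Ioi]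
    congr 1
    ext v
    by_cases hv : v ∈ Set.Ioi (0 : ℝ)
    · simp only [f, Set.indicator_of_mem hv, smul_eq_mul]
      rw [mul_left_comm, ← Complex.exp_add]
      congr 2
      push_cast
      ring
    · simp only [f, Set.indicator_of_notMem hv, smul_zero]
  have hFi : Integrable (𝓕 f) := by
    rw [hF]
    exact ((integrable_vertical_cpow hb hp).comp_mul_left'
      (show 2 * Real.pi ≠ 0 by positivity)).mul_const _
  have hev : f =ᶠ[nhds L] fun v => ((v ^ (p - 1) : ℝ) : ℂ) * Complex.exp (-((b : ℂ) * v)) := by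
    filter_upwards [Ioi_mem_nhds hL] with v hv using Set.indicator_of_mem hv _
  have hc : ContinuousAt f L := by
    refine ContinuousAt.congr ?_ hev.symm
    refine ContinuousAt.mul ?_ (by fun_prop)
    exact Complex.continuous_ofReal.continuousAt.comp
      (Real.continuousAt_rpow_const _ _ (Or.inl hL.ne'))
  have hinv := hf.fourierInv_fourier_eq hFi hc
  rw [Real.fourierInv_eq', hev.eq_of_nhds, hF] at hinv
  have hsub := Measure.integral_comp_mul_left (fun t : ℝ => ((b : ℂ) + t * Complex.I) ^
    ((-p : ℝ) : ℂ) * Complex.exp (((t : ℂ) * Complex.I) * L)) (2 * Real.pi)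
  have hG : (Real.Gamma p : ℂ) ≠ 0 := by
    exact_mod_cast (Real.Gamma_pos_of_pos (by linarith)).ne'
  have e1 : ∫ v : ℝ, Complex.exp (((2 * Real.pi * inner ℝ v L : ℝ) : ℂ) * Complex.I) •
      (((b : ℂ) + ((2 * Real.pi * v : ℝ) : ℂ) * Complex.I) ^ ((-p : ℝ) : ℂ) * Real.Gamma p) =
      Real.Gamma p * ∫ v : ℝ, ((b : ℂ) + ((2 * Real.pi * v : ℝ) : ℂ) * Complex.I) ^
      ((-p : ℝ) : ℂ) * Complex.exp ((((2 * Real.pi * v : ℝ) : ℂ) * Complex.I) * L) := by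
    rw [← integral_const_mul]
    congr 1
    ext v
    have : ((2 * Real.pi * inner ℝ v L : ℝ) : ℂ) * Complex.I =
        ((2 * Real.pi * v : ℝ) : ℂ) * Complex.I * L := by
      simp; ring
    rw [this, smul_eq_mul]
    ring
  rw [e1, hsub] at hinv
  have e2 : ∫ t : ℝ, ((b : ℂ) + t * Complex.I) ^ ((-p : ℝ) : ℂ) *
      Complex.exp (((b : ℂ) + t * Complex.I) * L) = Complex.exp ((b : ℂ) * L) *
      ∫ t : ℝ, ((b : ℂ) + t * Complex.I) ^ ((-p : ℝ) : ℂ) *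
        Complex.exp (((t : ℂ) * Complex.I) * L) := by
    rw [← integral_const_mul]
    congr 1
    ext t
    rw [add_mul, Complex.exp_add]
    ring
  rw [abs_of_pos (by positivity), Complex.real_smul] at hinv
  have hpi : (Real.pi : ℂ) ≠ 0 := by exact_mod_cast Real.pi_ne_zero
  have e3 : ∫ t : ℝ, ((b : ℂ) + t * Complex.I) ^ ((-p : ℝ) : ℂ) *
        Complex.exp (((t : ℂ) * Complex.I) * L) = 2 * Real.pi / Real.Gamma p *
        (((L ^ (p - 1) : ℝ) : ℂ) * Complex.exp (-((b : ℂ) * L))) := by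
    rw [← hinv]
    generalize (∫ t : ℝ, _ : ℂ) = J
    push_cast
    field_simp
  rw [e2, e3]
  rw [Complex.exp_neg]
  push_cast
  field_simp

/-! ### Perron's formula for Riesz means -/

open MeasureTheory in
theorem integrable_vertical_inv_mul {c : ℝ} (hc : 0 < c) :
    Integrable fun t : ℝ =>
      1 / (((c : ℂ) + t * Complex.I) * ((c : ℂ) + t * Complex.I + 1)) := by
  have h0 : ∀ t : ℝ, (c : ℂ) + t * Complex.I ≠ 0 := fun t h => by
    have := congrArg Complex.re h
    simp at this
    linarith
  have h1 : ∀ t : ℝ, (c : ℂ) + t * Complex.I + 1 ≠ 0 := fun t h => by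
    have := congrArg Complex.re h
    simp at this
    linarith
  have hcont : Continuous fun t : ℝ =>
      1 / (((c : ℂ) + t * Complex.I) * ((c : ℂ) + t * Complex.I + 1)) :=
    continuous_const.div (by fun_prop) fun t => mul_ne_zero (h0 t) (h1 t)
  refine ((integrable_add_abs_rpow hc (one_lt_two)).const_mul 4).mono'
    hcont.aestronglyMeasurable (Eventually.of_forall fun t => ?_)
  have e : (c : ℂ) + t * Complex.I + 1 = ((c + 1 : ℝ) : ℂ) + t * Complex.I := by
    push_cast; ring
  have n0 := norm_ofReal_add_mul_I_ge hc.le t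
  have n1 := norm_ofReal_add_mul_I_ge (by linarith : 0 ≤ c + 1) t
  have hpos : 0 < c + |t| := by positivity
  rw [norm_div, norm_one, norm_mul, e, Real.rpow_neg hpos.le, Real.rpow_two,
    ← div_eq_mul_inv, div_le_div_iff₀ (mul_pos (by linarith) (by linarith)) (by positivity),
    one_mul]
  have : (c + |t|) / 2 * ((c + |t|) / 2) ≤ ‖(c : ℂ) + t * Complex.I‖ *
      ‖((c + 1 : ℝ) : ℂ) + t * Complex.I‖ := by
    gcongr
    linarith
  linarith

open MeasureTheory in
theorem integral_vertical_riesz_kernel {c : ℝ} (hc : 0 < c) {y : ℝ} (hy : 0 < y) :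
    ∫ t : ℝ, (y : ℂ) ^ (-((c : ℂ) + t * Complex.I)) *
      (1 / (((c : ℂ) + t * Complex.I) * ((c : ℂ) + t * Complex.I + 1))) =
    ((2 * Real.pi * max 0 (1 - y) : ℝ) : ℂ) := by
  -- On `u > 0` this is `max 0 (1 - u)`, whose Mellin transform is `1/s - 1/(s+1)`; the claim is
  -- Mellin inversion at `y`.
  set f : ℝ → ℂ := fun u => (Set.Ioc (0 : ℝ) 1).indicator (fun _ => (1 : ℂ)) u -
    (Set.Ioc (0 : ℝ) 1).indicator (fun t : ℝ => (t : ℂ) ^ (1 : ℂ)) u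
  have hmel : ∀ s : ℂ, 0 < s.re → HasMellin f s (1 / (s * (s + 1))) := fun s hs => by
    have m1 := hasMellin_one_Ioc hs
    have m2 := hasMellin_cpow_Ioc 1 (s := s) (by simpa using by linarith)
    have m3 := hasMellin_sub m1.1 m2.1
    refine ⟨m3.1, m3.2.trans ?_⟩
    rw [m1.2, m2.2]
    have h0 : s ≠ 0 := by rintro rfl; simp at hs
    have h1 : s + 1 ≠ 0 := fun h => by
      have := congrArg Complex.re h
      simp at this
      linarith
    field_simp
    ring
  have hfeq : ∀ u : ℝ, 0 < u → f u = ((max 0 (1 - u) : ℝ) : ℂ) := fun u hu => by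
    simp only [f, Complex.cpow_one]
    by_cases h : u ≤ 1
    · have hm : u ∈ Set.Ioc (0 : ℝ) 1 := ⟨hu, h⟩
      rw [Set.indicator_of_mem hm, Set.indicator_of_mem hm, max_eq_right (by linarith)]
      push_cast; rfl
    · rw [Set.indicator_of_notMem (fun h' => h h'.2), Set.indicator_of_notMem (fun h' => h h'.2),
        max_eq_left (by linarith)]
      simp
  have hfc : ContinuousAt f y := by
    have hev : f =ᶠ[nhds y] fun u => ((max 0 (1 - u) : ℝ) : ℂ) := by
      filter_upwards [Ioi_mem_nhds hy] with u hu using hfeq u hu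
    refine ContinuousAt.congr ?_ hev.symm
    fun_prop
  have hre : ∀ t : ℝ, 0 < ((c : ℂ) + t * Complex.I).re := fun t => by simpa using hc
  have hv : Complex.VerticalIntegrable (mellin f) c := by
    refine (integrable_vertical_inv_mul hc).congr (Eventually.of_forall fun t => ?_)
    exact (hmel _ (hre t)).2.symm
  have := mellinInv_mellin_eq c f hy (hmel c (by simpa using hc)).1 hv hfc
  rw [mellinInv, hfeq y hy, Complex.real_smul] at this
  have hcongr : ∫ t : ℝ, (y : ℂ) ^ (-((c : ℂ) + t * Complex.I)) *
      (1 / (((c : ℂ) + t * Complex.I) * ((c : ℂ) + t * Complex.I + 1))) =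
      ∫ t : ℝ, (y : ℂ) ^ (-((c : ℂ) + t * Complex.I)) • mellin f ((c : ℂ) + t * Complex.I) := by
    congr 1
    ext t
    rw [(hmel _ (hre t)).2, smul_eq_mul]
  have hpi : (Real.pi : ℂ) ≠ 0 := by exact_mod_cast Real.pi_ne_zero
  rw [hcongr, Complex.ofReal_mul, ← this]
  generalize (∫ t : ℝ, _ : ℂ) = J
  push_cast
  field_simp

open MeasureTheory in
/-- Perron's formula for the first Riesz mean of a Dirichlet series. -/
theorem hasSum_riesz_mean {a : ℕ → ℝ} (ha0 : a 0 = 0) {c : ℝ} (hc : 0 < c)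
    (hs : LSeriesSummable (fun n => (a n : ℂ)) c) {x : ℝ} (hx : 0 < x) :
    Integrable (fun t : ℝ => LSeries (fun n => (a n : ℂ)) ((c : ℂ) + t * Complex.I) *
        (x : ℂ) ^ ((c : ℂ) + t * Complex.I + 1) *
        (1 / (((c : ℂ) + t * Complex.I) * ((c : ℂ) + t * Complex.I + 1)))) ∧
    HasSum (fun n : ℕ => ((2 * Real.pi * (a n * max 0 (x - n)) : ℝ) : ℂ))
      (∫ t : ℝ, LSeries (fun n => (a n : ℂ)) ((c : ℂ) + t * Complex.I) *
        (x : ℂ) ^ ((c : ℂ) + t * Complex.I + 1) *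
        (1 / (((c : ℂ) + t * Complex.I) * ((c : ℂ) + t * Complex.I + 1)))) := by
  have hxC : (x : ℂ) ≠ 0 := by exact_mod_cast hx.ne'
  set g : ℝ → ℂ := fun t => 1 / (((c : ℂ) + t * Complex.I) * ((c : ℂ) + t * Complex.I + 1))
  have hg : Integrable g := integrable_vertical_inv_mul hc
  set F : ℕ → ℝ → ℂ := fun n t =>
    LSeries.term (fun n => (a n : ℂ)) ((c : ℂ) + t * Complex.I) n *
      (x : ℂ) ^ ((c : ℂ) + t * Complex.I + 1) * g t
  set A : ℕ → ℝ := fun n => ‖LSeries.term (fun n => (a n : ℂ)) c n‖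
  have hA : Summable A := hs.norm
  have hxn : ∀ t : ℝ, ‖(x : ℂ) ^ ((c : ℂ) + t * Complex.I + 1)‖ = x ^ (c + 1) := fun t => by
    rw [Complex.norm_cpow_eq_rpow_re_of_pos hx]
    simp
  have hAn : ∀ n (t : ℝ), ‖LSeries.term (fun n => (a n : ℂ)) ((c : ℂ) + t * Complex.I) n‖ = A n := by
    intro n t
    simp only [A]
    rw [LSeries.norm_term_eq, LSeries.norm_term_eq]
    simp
  have hFn : ∀ n t, ‖F n t‖ = A n * x ^ (c + 1) * ‖g t‖ := fun n t => by
    simp only [F]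
    rw [norm_mul, norm_mul, hxn, hAn]
  have hFc : ∀ n, Continuous fun t : ℝ =>
      LSeries.term (fun n => (a n : ℂ)) ((c : ℂ) + t * Complex.I) n *
      (x : ℂ) ^ ((c : ℂ) + t * Complex.I + 1) := by
    intro n
    refine Continuous.mul ?_ (Continuous.const_cpow (by fun_prop) (Or.inl hxC))
    rcases Nat.eq_zero_or_pos n with rfl | hn
    · simp only [LSeries.term_zero]; exact continuous_const
    · have hn0 : (n : ℂ) ≠ 0 := by exact_mod_cast hn.ne'
      simp only [LSeries.term_of_ne_zero hn.ne']
      exact continuous_const.div (Continuous.const_cpow (by fun_prop) (Or.inl hn0))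
        fun t => by simp [Complex.cpow_eq_zero_iff, hn0]
  have hFi : ∀ n, Integrable (F n) := fun n => by
    refine (hg.norm.const_mul (A n * x ^ (c + 1))).mono'
      ((hFc n).aestronglyMeasurable.mul hg.aestronglyMeasurable)
      (Eventually.of_forall fun t => (hFn n t).le)
  have hsumF : Summable fun n => ∫ t, ‖F n t‖ := by
    simp_rw [hFn, integral_const_mul]
    exact (hA.mul_right _).mul_right _
  have key := hasSum_integral_of_summable_integral_norm hFi hsumF
  have htsum : ∀ t : ℝ, ∑' n, F n t = LSeries (fun n => (a n : ℂ)) ((c : ℂ) + t * Complex.I) *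
      (x : ℂ) ^ ((c : ℂ) + t * Complex.I + 1) * g t := fun t => by
    simp only [F, LSeries]
    rw [tsum_mul_right, tsum_mul_right]
  simp_rw [htsum] at key
  refine ⟨?_, ?_⟩
  · have hmeas : AEStronglyMeasurable (fun t => ∑' n, F n t) volume := by
      refine aestronglyMeasurable_of_tendsto_ae atTop
        (f := fun N t => ∑ n ∈ Finset.range N, F n t) (fun N => ?_)
        (Eventually.of_forall fun t => ?_)
      · exact Finset.aestronglyMeasurable_fun_sum _ fun n _ => (hFi n).aestronglyMeasurable
      · refine HasSum.tendsto_sum_nat (Summable.hasSum ?_)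
        refine Summable.of_norm ?_
        simp_rw [hFn]
        exact (hA.mul_right _).mul_right _
    simp_rw [htsum] at hmeas
    refine (hg.norm.const_mul ((∑' n, A n) * x ^ (c + 1))).mono' hmeas
      (Eventually.of_forall fun t => ?_)
    rw [norm_mul, norm_mul, hxn]
    gcongr
    exact tsum_of_norm_bounded hA.hasSum fun n => (hAn n t).le
  · suffices h : ∀ n : ℕ, ((2 * Real.pi * (a n * max 0 (x - n)) : ℝ) : ℂ) = ∫ t, F n t by
      simp_rw [h]
      exact key
    intro n
    rcases Nat.eq_zero_or_pos n with rfl | hn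
    · simp [F, ha0]
    have hn0 : (0 : ℝ) < n := by exact_mod_cast hn
    have hnC : (n : ℂ) ≠ 0 := by exact_mod_cast hn.ne'
    have hquot : ∀ s : ℂ, ((n / x : ℝ) : ℂ) ^ (-s) = (x : ℂ) ^ s / (n : ℂ) ^ s := fun s => by
      have hq : ((n / x : ℝ) : ℂ) ≠ 0 := by exact_mod_cast (div_pos hn0 hx).ne'
      rw [Complex.cpow_def_of_ne_zero hq, Complex.cpow_def_of_ne_zero hxC,
        Complex.cpow_def_of_ne_zero hnC, ← Complex.exp_sub, ← Complex.ofReal_log (by positivity),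
        ← Complex.ofReal_log hx.le, ← Complex.natCast_log, Real.log_div hn0.ne' hx.ne']
      congr 1
      push_cast
      ring
    have hF : ∀ t : ℝ, F n t = (a n : ℂ) * x *
        (((n / x : ℝ) : ℂ) ^ (-((c : ℂ) + t * Complex.I)) * g t) := fun t => by
      simp only [F]
      rw [LSeries.term_of_ne_zero hn.ne', hquot, Complex.cpow_add _ _ hxC, Complex.cpow_one]
      ring
    simp_rw [hF]
    rw [integral_const_mul, integral_vertical_riesz_kernel hc (div_pos hn0 hx)]
    have hmax : max 0 (x - n) = x * max 0 (1 - n / x) := by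
      rw [mul_max_of_nonneg _ _ hx.le, mul_zero, mul_sub, mul_one, mul_div_cancel₀ _ hx.ne']
    rw [hmax]
    push_cast
    ring

/-! ### Riesz sums and the Tauberian argument -/

/-- The first Riesz sum of a sequence, `∑_{n ≤ x} a n (x - n)`. -/
noncomputable def rieszSum (a : ℕ → ℝ) (x : ℝ) : ℝ := ∑' n : ℕ, a n * max 0 (x - n)

theorem summable_rieszSum (a : ℕ → ℝ) (x : ℝ) : Summable fun n : ℕ => a n * max 0 (x - n) := by
  refine summable_of_ne_finset_zero (s := Finset.range (⌊x⌋₊ + 1)) fun n hn => ?_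
  have hx : x < n := by
    have := Nat.lt_of_floor_lt (show ⌊x⌋₊ < n by simpa using hn)
    exact this
  rw [max_eq_left (by linarith), mul_zero]

/-- Passing from `x` to `y` raises the weight of each `n ≤ x` by exactly `y - x` and lowers no
weight. -/
theorem mul_sum_le_rieszSum_sub {a : ℕ → ℝ} (ha : ∀ n, 0 ≤ a n) {x y : ℝ} (hx : 0 ≤ x)
    (hxy : x ≤ y) :
    (y - x) * ∑ n ∈ Finset.Icc 1 ⌊x⌋₊, a n ≤ rieszSum a y - rieszSum a x := by
  rw [rieszSum, rieszSum, ← (summable_rieszSum a y).tsum_sub (summable_rieszSum a x),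
    Finset.mul_sum]
  refine le_trans (Finset.sum_le_sum fun n hn => ?_)
    (((summable_rieszSum a y).sub (summable_rieszSum a x)).sum_le_tsum (Finset.Icc 1 ⌊x⌋₊)
      fun n _ => ?_)
  · have hnx : (n : ℝ) ≤ x := (Nat.le_floor_iff hx).mp (Finset.mem_Icc.mp hn).2
    rw [max_eq_right (by linarith), max_eq_right (by linarith)]
    exact le_of_eq (by ring)
  · rw [← mul_sub]
    exact mul_nonneg (ha n) (sub_nonneg.mpr (max_le_max le_rfl (by linarith)))

theorem rieszSum_sub_le_mul_sum {a : ℕ → ℝ} (ha : ∀ n, 0 ≤ a n) (ha0 : a 0 = 0) {x y : ℝ}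
    (hxy : x ≤ y) :
    rieszSum a y - rieszSum a x ≤ (y - x) * ∑ n ∈ Finset.Icc 1 ⌊y⌋₊, a n := by
  rw [rieszSum, rieszSum, ← (summable_rieszSum a y).tsum_sub (summable_rieszSum a x),
    Finset.mul_sum, tsum_eq_sum (s := Finset.Icc 1 ⌊y⌋₊)]
  · refine Finset.sum_le_sum fun n _ => ?_
    rw [← mul_sub, mul_comm (y - x)]
    refine mul_le_mul_of_nonneg_left ?_ (ha n)
    have h1 : x - n ≤ max 0 (x - n) := le_max_right _ _
    have h2 : 0 ≤ max 0 (x - n) := le_max_left _ _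
    rw [sub_le_iff_le_add]
    exact max_le (by linarith) (by linarith)
  · intro n hn
    rcases Nat.eq_zero_or_pos n with rfl | hn0
    · simp [ha0]
    have hny : y < n := by
      refine Nat.lt_of_floor_lt ?_
      by_contra h
      exact hn (Finset.mem_Icc.mpr ⟨hn0, not_lt.mp h⟩)
    rw [max_eq_left (by linarith), max_eq_left (by linarith)]
    ring

/-- The difference between a Dirichlet series and the transform of `κ x² (log x)^(3/2) / 2`. -/
noncomputable def singularDiff (a : ℕ → ℝ) (κ : ℝ) (s : ℂ) : ℂ :=
  LSeries (fun n => (a n : ℂ)) s -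
    ((κ * Real.Gamma (5 / 2) / 2 : ℝ) : ℂ) * (s * (s + 1)) * (s - 1) ^ ((-(5 / 2) : ℝ) : ℂ)

open MeasureTheory in
-- In the subtracted term `s (s+1)` cancels the kernel, so its integral is an exact inverse Laplace
-- transform at `log x` and only the difference remains under the integral.
theorem rieszSum_sub_eq_integral {a : ℕ → ℝ} (ha0 : a 0 = 0) (κ : ℝ) {c : ℝ} (hc : 1 < c)
    (hs : LSeriesSummable (fun n => (a n : ℂ)) c) {x : ℝ} (hx : 1 < x) :
    Integrable (fun t : ℝ => singularDiff a κ ((c : ℂ) + t * Complex.I) *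
      (x : ℂ) ^ ((c : ℂ) + t * Complex.I + 1) *
        (1 / (((c : ℂ) + t * Complex.I) * ((c : ℂ) + t * Complex.I + 1)))) ∧
    ((2 * Real.pi * (rieszSum a x - κ * (x ^ 2 * Real.log x ^ (3 / 2 : ℝ) / 2)) : ℝ) : ℂ) =
      ∫ t : ℝ, singularDiff a κ ((c : ℂ) + t * Complex.I) *
      (x : ℂ) ^ ((c : ℂ) + t * Complex.I + 1) *
        (1 / (((c : ℂ) + t * Complex.I) * ((c : ℂ) + t * Complex.I + 1))) := by
  have hx0 : 0 < x := by linarith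
  have hxC : (x : ℂ) ≠ 0 := by exact_mod_cast hx0.ne'
  obtain ⟨hI, hS⟩ := hasSum_riesz_mean ha0 (by linarith) hs hx0
  have hsum : ((2 * Real.pi * rieszSum a x : ℝ) : ℂ) = ∫ t : ℝ,
      LSeries (fun n => (a n : ℂ)) ((c : ℂ) + t * Complex.I) *
        (x : ℂ) ^ ((c : ℂ) + t * Complex.I + 1) *
        (1 / (((c : ℂ) + t * Complex.I) * ((c : ℂ) + t * Complex.I + 1))) := by
    refine HasSum.unique ?_ hS
    exact Complex.hasSum_ofReal.mpr ((summable_rieszSum a x).hasSum.mul_left _)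
  have hb : 0 < c - 1 := by linarith
  set k : ℂ := ((κ * Real.Gamma (5 / 2) / 2 : ℝ) : ℂ)
  have hpt : ∀ t : ℝ, k * (((c : ℂ) + t * Complex.I) * ((c : ℂ) + t * Complex.I + 1)) *
      ((c : ℂ) + t * Complex.I - 1) ^ ((-(5 / 2) : ℝ) : ℂ) *
      (x : ℂ) ^ ((c : ℂ) + t * Complex.I + 1) *
      (1 / (((c : ℂ) + t * Complex.I) * ((c : ℂ) + t * Complex.I + 1))) =
      k * x ^ 2 * ((((c - 1 : ℝ) : ℂ) + t * Complex.I) ^ ((-(5 / 2) : ℝ) : ℂ) *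
        Complex.exp ((((c - 1 : ℝ) : ℂ) + t * Complex.I) * Real.log x)) := fun t => by
    have h0 : (c : ℂ) + t * Complex.I ≠ 0 := fun h => by
      have := congrArg Complex.re h
      simp at this
      linarith
    have h1 : (c : ℂ) + t * Complex.I + 1 ≠ 0 := fun h => by
      have := congrArg Complex.re h
      simp at this
      linarith
    have e1 : (c : ℂ) + t * Complex.I - 1 = ((c - 1 : ℝ) : ℂ) + t * Complex.I := by
      push_cast; ring
    have e2 : (x : ℂ) ^ ((c : ℂ) + t * Complex.I + 1) =
        x ^ 2 * Complex.exp ((((c - 1 : ℝ) : ℂ) + t * Complex.I) * Real.log x) := by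
      have : (c : ℂ) + t * Complex.I + 1 = (2 : ℕ) + (((c - 1 : ℝ) : ℂ) + t * Complex.I) := by
        push_cast; ring
      rw [this, Complex.cpow_add _ _ hxC, Complex.cpow_natCast, Complex.cpow_def_of_ne_zero hxC,
        Complex.ofReal_log hx0.le, mul_comm (Complex.log _)]
    rw [e1, e2]
    field_simp
  have hI2 : Integrable fun t : ℝ => (((c - 1 : ℝ) : ℂ) + t * Complex.I) ^ ((-(5 / 2) : ℝ) : ℂ) *
        Complex.exp ((((c - 1 : ℝ) : ℂ) + t * Complex.I) * Real.log x) := by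
    refine (integrable_vertical_cpow hb (by norm_num : (1 : ℝ) < 5 / 2)).mul_bdd
      (c := Real.exp ((c - 1) * Real.log x)) ?_ ?_
    · exact Continuous.aestronglyMeasurable (by fun_prop)
    · refine Eventually.of_forall fun t => le_of_eq ?_
      rw [Complex.norm_exp]
      simp
  have hsplit : ∀ t : ℝ, singularDiff a κ ((c : ℂ) + t * Complex.I) *
      (x : ℂ) ^ ((c : ℂ) + t * Complex.I + 1) *
        (1 / (((c : ℂ) + t * Complex.I) * ((c : ℂ) + t * Complex.I + 1))) =
      LSeries (fun n => (a n : ℂ)) ((c : ℂ) + t * Complex.I) *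
        (x : ℂ) ^ ((c : ℂ) + t * Complex.I + 1) *
        (1 / (((c : ℂ) + t * Complex.I) * ((c : ℂ) + t * Complex.I + 1))) -
      k * x ^ 2 * ((((c - 1 : ℝ) : ℂ) + t * Complex.I) ^ ((-(5 / 2) : ℝ) : ℂ) *
        Complex.exp ((((c - 1 : ℝ) : ℂ) + t * Complex.I) * Real.log x)) := fun t => by
    rw [← hpt, singularDiff]
    ring
  simp_rw [hsplit]
  refine ⟨hI.sub (hI2.const_mul _), ?_⟩
  rw [integral_sub hI (hI2.const_mul _), ← hsum, integral_const_mul,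
    integral_vertical_cpow_mul_cexp hb (by norm_num) (Real.log_pos hx)]
  have hG : (Real.Gamma (5 / 2) : ℂ) ≠ 0 := by
    exact_mod_cast (Real.Gamma_pos_of_pos (by norm_num)).ne'
  have e : (5 / 2 - 1 : ℝ) = 3 / 2 := by norm_num
  rw [e]
  simp only [k]
  push_cast
  field_simp

theorem norm_cpow_sub_cpow_le {x y : ℝ} (hx : 0 < x) (hy : 0 < y) (hyx : y ≤ 2 * x) {s : ℂ}
    (hs : 0 < s.re) :
    ‖(y : ℂ) ^ (s + 1) - (x : ℂ) ^ (s + 1)‖ ≤ ‖s + 1‖ * (2 * x) ^ s.re * |y - x| ∧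
    ‖(y : ℂ) ^ (s + 1) - (x : ℂ) ^ (s + 1)‖ ≤ 2 * (2 * x) ^ (s.re + 1) := by
  have hs1 : s + 1 ≠ 0 := fun h => by
    have := congrArg Complex.re h
    simp at this
    linarith
  constructor
  · have hd : ∀ u ∈ Set.Ioc 0 (2 * x), HasDerivWithinAt (fun u : ℝ => (u : ℂ) ^ (s + 1))
        ((s + 1) * (u : ℂ) ^ (s + 1 - 1)) (Set.Ioc 0 (2 * x)) u := fun u hu =>
      (hasDerivAt_ofReal_cpow_const (ne_of_gt hu.1) hs1).hasDerivWithinAt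
    refine (convex_Ioc 0 (2 * x)).norm_image_sub_le_of_norm_hasDerivWithin_le hd
      (fun u hu => ?_) ⟨hx, by linarith⟩ ⟨hy, hyx⟩
    rw [norm_mul, add_sub_cancel_right, Complex.norm_cpow_eq_rpow_re_of_pos hu.1]
    gcongr
    · exact hu.1.le
    · exact hu.2
  · refine (norm_sub_le _ _).trans ?_
    rw [Complex.norm_cpow_eq_rpow_re_of_pos hx, Complex.norm_cpow_eq_rpow_re_of_pos hy,
      Complex.add_re, Complex.one_re, two_mul]
    gcongr
    linarith

/-- The mean value inequality gives size `x²/L` with decay `1/|s|`, and the trivial bound gives `x²`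
with decay `1/|s|²`. The first serves near the pole. Their geometric mean, `x²/√L` with decay
`|s|^(-3/2)`, is integrable even against `(1+|t|)^(1/4)`. -/
theorem norm_riesz_kernel_sub_le {L x y : ℝ} (hL : 2 ≤ L) (hx : x = Real.exp L)
    (hxy : |y - x| ≤ x / L) (t : ℝ) :
    ‖((y : ℂ) ^ (((1 + 1 / L : ℝ) : ℂ) + t * Complex.I + 1) -
        (x : ℂ) ^ (((1 + 1 / L : ℝ) : ℂ) + t * Complex.I + 1)) *
      (1 / ((((1 + 1 / L : ℝ) : ℂ) + t * Complex.I) *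
        (((1 + 1 / L : ℝ) : ℂ) + t * Complex.I + 1)))‖ ≤
      12 * (x ^ 2 / L) ∧
    ‖((y : ℂ) ^ (((1 + 1 / L : ℝ) : ℂ) + t * Complex.I + 1) -
        (x : ℂ) ^ (((1 + 1 / L : ℝ) : ℂ) + t * Complex.I + 1)) *
      (1 / ((((1 + 1 / L : ℝ) : ℂ) + t * Complex.I) *
        (((1 + 1 / L : ℝ) : ℂ) + t * Complex.I + 1)))‖ ≤
      72 * (x ^ 2 / L) * √L * (1 + |t|) ^ (-(3 / 2) : ℝ) := by
  have hL0 : 0 < L := by linarith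
  have hx0 : 0 < x := hx ▸ Real.exp_pos L
  have hLinv : 1 / L ≤ 1 := by rw [div_le_one hL0]; linarith
  have hLinv0 : 0 < 1 / L := by positivity
  have hxL : x / L ≤ x / 2 := by gcongr
  rw [abs_le] at hxy
  have hy0 : 0 < y := by linarith
  have hy2 : y ≤ 2 * x := by linarith
  set c : ℝ := 1 + 1 / L
  set s : ℂ := (c : ℂ) + t * Complex.I
  have hre : s.re = c := by simp [s]
  have him : s.im = t := by simp [s]
  obtain ⟨h1, h2⟩ := norm_cpow_sub_cpow_le hx0 hy0 hy2 (s := s) (by rw [hre]; linarith)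
  rw [hre] at h1 h2
  have hyx : |y - x| ≤ x / L := abs_le.mpr hxy
  have hpow : (2 * x) ^ c ≤ 12 * x := by
    rw [Real.mul_rpow (by norm_num) hx0.le]
    have e1 : (2 : ℝ) ^ c ≤ 4 := by
      calc (2 : ℝ) ^ c ≤ 2 ^ (2 : ℝ) :=
            Real.rpow_le_rpow_of_exponent_le (by norm_num) (by linarith)
        _ = 4 := by norm_num
    -- The line `c = 1 + 1/L` is chosen so that `x^(1/L) = e`.
    have e2 : x ^ c = x * Real.exp 1 := by
      rw [hx, ← Real.exp_mul, ← Real.exp_add]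
      congr 1
      simp only [c]
      field_simp
    have e3 : Real.exp 1 ≤ 3 := Real.exp_one_lt_three.le
    rw [e2]
    calc (2 : ℝ) ^ c * (x * Real.exp 1) ≤ 4 * (x * 3) := by gcongr
      _ = 12 * x := by ring
  have hpow' : (2 * x) ^ (c + 1) ≤ 24 * x ^ 2 := by
    rw [Real.rpow_add_one (by positivity)]
    calc (2 * x) ^ c * (2 * x) ≤ 12 * x * (2 * x) := by gcongr
      _ = _ := by ring
  have hs1 : 1 ≤ ‖s‖ := by
    have := Complex.re_le_norm s
    rw [hre] at this
    linarith
  have hss : ‖s‖ ≤ ‖s + 1‖ := by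
    rw [Complex.norm_def, Complex.norm_def]
    refine Real.sqrt_le_sqrt ?_
    rw [Complex.normSq_apply, Complex.normSq_apply]
    simp only [Complex.add_re, Complex.one_re, Complex.add_im, Complex.one_im, hre]
    nlinarith
  have hst : (1 + |t|) / 2 ≤ ‖s‖ := by
    have h := Complex.abs_im_le_norm s
    rw [him] at h
    linarith
  set W := ‖((y : ℂ) ^ (s + 1) - (x : ℂ) ^ (s + 1)) * (1 / (s * (s + 1)))‖ with hW
  have hWeq : W * (‖s‖ * ‖s + 1‖) = ‖(y : ℂ) ^ (s + 1) - (x : ℂ) ^ (s + 1)‖ := by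
    rw [hW, norm_mul, norm_div, norm_one, norm_mul]
    have : ‖s‖ ≠ 0 := by linarith
    have : ‖s + 1‖ ≠ 0 := by linarith
    field_simp
  have hW0 : 0 ≤ W := norm_nonneg _
  have hs1pos : 0 < ‖s + 1‖ := by linarith
  have b1 : W * ‖s‖ ≤ 12 * (x ^ 2 / L) := by
    have : W * ‖s‖ * ‖s + 1‖ ≤ 12 * (x ^ 2 / L) * ‖s + 1‖ := by
      calc W * ‖s‖ * ‖s + 1‖ = W * (‖s‖ * ‖s + 1‖) := by ring
        _ ≤ ‖s + 1‖ * (2 * x) ^ c * |y - x| := hWeq.trans_le h1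
        _ ≤ ‖s + 1‖ * (12 * x) * (x / L) := by gcongr
        _ = _ := by ring
    exact le_of_mul_le_mul_right this hs1pos
  have b2 : W * ‖s‖ ^ 2 ≤ 48 * x ^ 2 := by
    calc W * ‖s‖ ^ 2 = W * (‖s‖ * ‖s‖) := by ring
      _ ≤ W * (‖s‖ * ‖s + 1‖) := by gcongr
      _ ≤ 2 * (2 * x) ^ (c + 1) := hWeq.trans_le h2
      _ ≤ 2 * (24 * x ^ 2) := by gcongr
      _ = _ := by ring
  refine ⟨(le_mul_of_one_le_right hW0 hs1).trans b1, ?_⟩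
  set τ := 1 + |t|
  have hτ : 0 < τ := by positivity
  have b3 : W ^ 2 * τ ^ 3 ≤ 8 * (12 * (x ^ 2 / L) * (48 * x ^ 2)) := by
    have e : τ ^ 3 ≤ 8 * ‖s‖ ^ 3 := by
      calc τ ^ 3 ≤ (2 * ‖s‖) ^ 3 := by gcongr; linarith
        _ = _ := by ring
    calc W ^ 2 * τ ^ 3 ≤ W ^ 2 * (8 * ‖s‖ ^ 3) := by gcongr
      _ = 8 * ((W * ‖s‖) * (W * ‖s‖ ^ 2)) := by ring
      _ ≤ _ := by gcongr
  refine le_of_pow_le_pow_left₀ (n := 2) two_ne_zero (by positivity) ?_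
  have hτ3 : (τ ^ (-(3 / 2) : ℝ)) ^ 2 = (τ ^ 3)⁻¹ := by
    rw [← Real.rpow_natCast, ← Real.rpow_mul hτ.le, ← Real.rpow_natCast, ← Real.rpow_neg hτ.le]
    norm_num
  rw [mul_pow, mul_pow, hτ3, Real.sq_sqrt hL0.le, ← div_eq_mul_inv, le_div_iff₀ (by positivity)]
  refine b3.trans ?_
  have : 8 * (12 * (x ^ 2 / L) * (48 * x ^ 2)) = 4608 * (x ^ 4 / L) := by ring
  rw [this]
  have : (72 * (x ^ 2 / L)) ^ 2 * L = 5184 * (x ^ 4 / L) := by field_simp; ring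
  rw [this]
  have : 0 ≤ x ^ 4 / L := by positivity
  linarith

open MeasureTheory in
/-- The Riesz sum, minus its main term, varies little over intervals of length `x / log x`. -/
theorem exists_abs_rieszSum_sub_le {a : ℕ → ℝ} (ha0 : a 0 = 0) {κ δ C : ℝ}
    (hs : ∀ c : ℝ, 1 < c → LSeriesSummable (fun n => (a n : ℂ)) c) (hδ : 0 < δ) (hC : 0 ≤ C)
    (hE : ∀ s : ℂ, 1 < s.re → s.re ≤ 1 + δ → ‖singularDiff a κ s‖ ≤
      C * ((s.re - 1 + |s.im|) ^ (-(3 / 2) : ℝ) + (1 + |s.im|) ^ (1 / 4 : ℝ))) :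
    ∃ C₁ L₀ : ℝ, 0 ≤ C₁ ∧ 2 ≤ L₀ ∧ ∀ L x y : ℝ, L₀ ≤ L → x = Real.exp L → |y - x| ≤ x / L →
      |(rieszSum a y - κ * (y ^ 2 * Real.log y ^ (3 / 2 : ℝ) / 2)) -
        (rieszSum a x - κ * (x ^ 2 * Real.log x ^ (3 / 2 : ℝ) / 2))| ≤
      C₁ * (x ^ 2 / L) * √L := by
  set J₁ : ℝ := ∫ t : ℝ, (1 + |t|) ^ (-(3 / 2) : ℝ)
  set J₂ : ℝ := ∫ t : ℝ, (1 + |t|) ^ (-(5 / 4) : ℝ)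
  have hJ₁ : 0 ≤ J₁ := integral_nonneg fun t => by positivity
  have hJ₂ : 0 ≤ J₂ := integral_nonneg fun t => by positivity
  -- The condition `L ≥ 1/δ` puts the line `1 + 1/L` inside the strip where the bound on
  -- `singularDiff` holds. The constants 12 and 72 come from the two kernel bounds.
  refine ⟨C * (12 * J₁ + 72 * J₂), max 2 (1 / δ), by positivity, le_max_left _ _,
    fun L x y hL hx hxy => ?_⟩
  have hL2 : 2 ≤ L := (le_max_left _ _).trans hL
  have hLδ : 1 / L ≤ δ := by
    have : 1 / δ ≤ L := (le_max_right _ _).trans hL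
    exact (one_div_le (by linarith) hδ).mpr this
  have hL0 : 0 < L := by linarith
  have hLinv : 0 < 1 / L := by positivity
  have hx2 : 2 < x := by
    rw [hx]
    linarith [Real.add_one_le_exp L]
  have hy1 : 1 < y := by
    have hxL : x / L ≤ x / 2 := by gcongr
    rw [abs_le] at hxy
    linarith
  have hc : 1 < 1 + 1 / L := by linarith
  obtain ⟨iy, ey⟩ := rieszSum_sub_eq_integral ha0 κ hc (hs _ hc) hy1
  obtain ⟨ix, ex⟩ := rieszSum_sub_eq_integral ha0 κ hc (hs _ hc) (by linarith : 1 < x)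
  set Qy := rieszSum a y - κ * (y ^ 2 * Real.log y ^ (3 / 2 : ℝ) / 2)
  set Qx := rieszSum a x - κ * (x ^ 2 * Real.log x ^ (3 / 2 : ℝ) / 2)
  have hdiff : ((2 * Real.pi * (Qy - Qx) : ℝ) : ℂ) = ∫ t : ℝ,
      (singularDiff a κ (((1 + 1 / L : ℝ) : ℂ) + t * Complex.I) *
      (y : ℂ) ^ (((1 + 1 / L : ℝ) : ℂ) + t * Complex.I + 1) *
        (1 / ((((1 + 1 / L : ℝ) : ℂ) + t * Complex.I) *
          (((1 + 1 / L : ℝ) : ℂ) + t * Complex.I + 1))) -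
      singularDiff a κ (((1 + 1 / L : ℝ) : ℂ) + t * Complex.I) *
      (x : ℂ) ^ (((1 + 1 / L : ℝ) : ℂ) + t * Complex.I + 1) *
        (1 / ((((1 + 1 / L : ℝ) : ℂ) + t * Complex.I) *
          (((1 + 1 / L : ℝ) : ℂ) + t * Complex.I + 1)))) := by
    rw [integral_sub iy ix, ← ey, ← ex]
    push_cast
    ring
  set K := x ^ 2 / L
  have hK : 0 ≤ K := by positivity
  have g1 := integrable_add_abs_rpow hLinv (by norm_num : (1 : ℝ) < 3 / 2)
  have g2 := integrable_add_abs_rpow one_pos (by norm_num : (1 : ℝ) < 5 / 4)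
  have hbound := norm_integral_le_of_norm_le (μ := volume) (f := fun t : ℝ =>
      singularDiff a κ (((1 + 1 / L : ℝ) : ℂ) + t * Complex.I) *
      (y : ℂ) ^ (((1 + 1 / L : ℝ) : ℂ) + t * Complex.I + 1) *
        (1 / ((((1 + 1 / L : ℝ) : ℂ) + t * Complex.I) *
          (((1 + 1 / L : ℝ) : ℂ) + t * Complex.I + 1))) -
      singularDiff a κ (((1 + 1 / L : ℝ) : ℂ) + t * Complex.I) *
      (x : ℂ) ^ (((1 + 1 / L : ℝ) : ℂ) + t * Complex.I + 1) *
        (1 / ((((1 + 1 / L : ℝ) : ℂ) + t * Complex.I) *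
          (((1 + 1 / L : ℝ) : ℂ) + t * Complex.I + 1))))
    (g := fun t : ℝ => C * (12 * K) * (1 / L + |t|) ^ (-(3 / 2) : ℝ) +
      C * (72 * K * √L) * (1 + |t|) ^ (-(5 / 4) : ℝ))
    ((g1.const_mul _).add (g2.const_mul _)) (Eventually.of_forall fun t => ?_)
  · rw [← hdiff, Complex.norm_real, integral_add (g1.const_mul _) (g2.const_mul _),
      integral_const_mul, integral_const_mul, integral_add_abs_rpow hLinv] at hbound
    have eL : (1 / L) ^ (1 - 3 / 2 : ℝ) = √L := by
      rw [one_div, Real.inv_rpow hL0.le, ← Real.rpow_neg hL0.le, Real.sqrt_eq_rpow]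
      norm_num
    rw [eL, Real.norm_eq_abs, abs_mul, abs_of_pos (by positivity : 0 < 2 * Real.pi)] at hbound
    have hpi : 1 ≤ 2 * Real.pi := by linarith [Real.pi_gt_three]
    calc |Qy - Qx| ≤ 2 * Real.pi * |Qy - Qx| := le_mul_of_one_le_left (abs_nonneg _) hpi
      _ ≤ C * (12 * K) * (√L * J₁) + C * (72 * K * √L) * J₂ := hbound
      _ = _ := by ring
  · obtain ⟨k1, k2⟩ := norm_riesz_kernel_sub_le hL2 hx hxy t
    set s : ℂ := ((1 + 1 / L : ℝ) : ℂ) + t * Complex.I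
    have hre : s.re = 1 + 1 / L := by simp [s]
    have him : s.im = t := by simp [s]
    have he := hE s (by rw [hre]; exact hc) (by rw [hre]; linarith)
    rw [hre, him, add_sub_cancel_left] at he
    set X := (1 / L + |t|) ^ (-(3 / 2) : ℝ)
    have hX : 0 ≤ X := by positivity
    set W := ‖((y : ℂ) ^ (s + 1) - (x : ℂ) ^ (s + 1)) * (1 / (s * (s + 1)))‖
    have hτ : (0 : ℝ) < 1 + |t| := by positivity
    have hτe : (1 + |t|) ^ (1 / 4 : ℝ) * (1 + |t|) ^ (-(3 / 2) : ℝ) =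
        (1 + |t|) ^ (-(5 / 4) : ℝ) := by
      rw [← Real.rpow_add hτ]; norm_num
    have e : singularDiff a κ s * (y : ℂ) ^ (s + 1) * (1 / (s * (s + 1))) -
        singularDiff a κ s * (x : ℂ) ^ (s + 1) * (1 / (s * (s + 1))) =
        singularDiff a κ s *
          (((y : ℂ) ^ (s + 1) - (x : ℂ) ^ (s + 1)) * (1 / (s * (s + 1)))) := by ring
    rw [e, norm_mul]
    calc ‖singularDiff a κ s‖ * W ≤ C * (X + (1 + |t|) ^ (1 / 4 : ℝ)) * W := by gcongr
      _ = C * (X * W) + C * ((1 + |t|) ^ (1 / 4 : ℝ) * W) := by ring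
      _ ≤ C * (X * (12 * K)) + C * ((1 + |t|) ^ (1 / 4 : ℝ) *
          (72 * K * √L * (1 + |t|) ^ (-(3 / 2) : ℝ))) := by gcongr
      _ = C * (12 * K) * X + C * (72 * K * √L) *
          ((1 + |t|) ^ (1 / 4 : ℝ) * (1 + |t|) ^ (-(3 / 2) : ℝ)) := by ring
      _ = _ := by rw [hτe]

/-- The derivative of `u² (log u)^(3/2) / 2` differs from `x L^(3/2)` by `O(x √L)` when `|u - x| ≤
x/L`, since `log u` then moves by `O(1/L)`. -/
theorem abs_sq_mul_log_rpow_sub_le {L x y : ℝ} (hL : 2 ≤ L) (hx : x = Real.exp L)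
    (hxy : |y - x| ≤ x / L) :
    |y ^ 2 * Real.log y ^ (3 / 2 : ℝ) / 2 - x ^ 2 * Real.log x ^ (3 / 2 : ℝ) / 2 -
      (y - x) * (x * L ^ (3 / 2 : ℝ))| ≤ 18 * x * √L * |y - x| := by
  have hL0 : 0 < L := by linarith
  have hx0 : 0 < x := hx ▸ Real.exp_pos L
  have hlogx : Real.log x = L := by rw [hx, Real.log_exp]
  have hxL : x / L ≤ x / 2 := by gcongr
  set I : Set ℝ := Set.Icc (x - x / L) (x + x / L)
  have hsq32 : ∀ l : ℝ, 0 ≤ l → l ^ (3 / 2 : ℝ) = √l ^ 3 := fun l hl => by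
    rw [Real.sqrt_eq_rpow, ← Real.rpow_natCast, ← Real.rpow_mul hl]; norm_num
  have hsq12 : ∀ l : ℝ, l ^ (1 / 2 : ℝ) = √l := fun l => (Real.sqrt_eq_rpow l).symm
  have hlog : ∀ u ∈ I, 0 < u ∧ u ≤ 2 * x ∧ |u - x| ≤ x / L ∧ |Real.log u - L| ≤ 2 / L := by
    intro u hu
    have hu0 : 0 < u := by linarith [hu.1]
    have hux : |u - x| ≤ x / L := by rw [abs_le]; constructor <;> linarith [hu.1, hu.2]
    refine ⟨hu0, by linarith [hu.2], hux, ?_⟩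
    rw [abs_le] at hux ⊢
    have e : Real.log u - L = Real.log (u / x) := by
      rw [Real.log_div hu0.ne' hx0.ne', hlogx]
    rw [e]
    have hq0 : 0 < u / x := by positivity
    have hq1 : u / x ≤ 1 + 1 / L := by
      rw [div_le_iff₀ hx0]
      calc u ≤ x + x / L := by linarith
        _ = _ := by ring
    have hq2 : 1 - 1 / L ≤ u / x := by
      rw [le_div_iff₀ hx0]
      calc (1 - 1 / L) * x = x - x / L := by ring
        _ ≤ u := by linarith
    have hLi : 1 / L ≤ 1 / 2 := by gcongr
    have hLi0 : 0 < 1 / L := by positivity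
    have e2 : 2 / L = 2 * (1 / L) := by ring
    rw [e2]
    constructor
    · have h1 := Real.one_sub_inv_le_log_of_pos hq0
      have h2 : (u / x)⁻¹ ≤ 1 + 2 * (1 / L) := by
        rw [inv_le_comm₀ hq0 (by positivity)]
        refine le_trans ?_ hq2
        rw [inv_le_iff_one_le_mul₀ (by positivity)]
        nlinarith
      linarith
    · have h1 := Real.log_le_sub_one_of_pos hq0
      linarith
  set q := √L
  have hq0 : 0 < q := Real.sqrt_pos.mpr hL0
  have hq2 : q ^ 2 = L := Real.sq_sqrt hL0.le
  set M : ℝ → ℝ := fun u => u ^ 2 * Real.log u ^ (3 / 2 : ℝ) / 2 - u * (x * q ^ 3)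
  have hL1 : 2 / L ≤ 1 := by rw [div_le_one hL0]; exact hL
  have hd : ∀ u ∈ I, HasDerivWithinAt M
      (u * Real.log u ^ (3 / 2 : ℝ) + 3 / 4 * u * Real.log u ^ (1 / 2 : ℝ) - x * q ^ 3) I u := by
    intro u hu
    obtain ⟨hu0, -, -, hl⟩ := hlog u hu
    rw [abs_le] at hl
    have hlu : Real.log u ≠ 0 := by
      have : 0 < Real.log u := by linarith [hl.1]
      exact this.ne'
    have h1 := ((Real.hasDerivAt_log hu0.ne').rpow_const (p := 3 / 2) (Or.inl hlu))
    have h2 := (((hasDerivAt_pow 2 u).mul h1).div_const 2).sub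
      ((hasDerivAt_id u).mul_const (x * q ^ 3))
    refine (h2.congr_deriv ?_).hasDerivWithinAt
    have e : (3 / 2 - 1 : ℝ) = 1 / 2 := by norm_num
    rw [e]
    field_simp
    ring
  have hb : ∀ u ∈ I, ‖u * Real.log u ^ (3 / 2 : ℝ) + 3 / 4 * u * Real.log u ^ (1 / 2 : ℝ) -
      x * q ^ 3‖ ≤ 18 * x * q := by
    intro u hu
    obtain ⟨hu0, hu2, hux, hl⟩ := hlog u hu
    have hl1 : |Real.log u - L| ≤ 1 := hl.trans hL1
    have hlu : 0 ≤ Real.log u := by linarith [(abs_le.mp hl1).1]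
    rw [hsq32 _ hlu, hsq12]
    set p := √(Real.log u)
    have hp0 : 0 ≤ p := Real.sqrt_nonneg _
    have hp2 : p ^ 2 = Real.log u := Real.sq_sqrt hlu
    have hp2q : p ≤ 2 * q := by
      refine le_of_pow_le_pow_left₀ (n := 2) two_ne_zero (by positivity) ?_
      rw [mul_pow, hp2, hq2]
      linarith [(abs_le.mp hl1).2]
    have hpq : |p - q| * q ≤ 1 := by
      calc |p - q| * q ≤ |p - q| * |p + q| := by
            gcongr
            rw [abs_of_nonneg (by positivity)]
            linarith
        _ = |p ^ 2 - q ^ 2| := by rw [← abs_mul]; congr 1; ring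
        _ ≤ 1 := by rwa [hp2, hq2]
    have t1 : |(u - x) * p ^ 3| ≤ 8 * (x * q) := by
      rw [abs_mul, abs_of_nonneg (by positivity : 0 ≤ p ^ 3)]
      calc |u - x| * p ^ 3 ≤ x / L * (2 * q) ^ 3 := by gcongr
        _ = 8 * (x * q) * (q ^ 2 / L) := by ring
        _ = _ := by rw [hq2, div_self hL0.ne', mul_one]
    have t2 : |x * (p ^ 3 - q ^ 3)| ≤ 7 * (x * q) := by
      have e : p ^ 3 - q ^ 3 = (p - q) * (p ^ 2 + p * q + q ^ 2) := by ring
      rw [e, abs_mul, abs_mul, abs_of_pos hx0,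
        abs_of_nonneg (by positivity : 0 ≤ p ^ 2 + p * q + q ^ 2)]
      calc x * (|p - q| * (p ^ 2 + p * q + q ^ 2))
          ≤ x * (|p - q| * ((2 * q) ^ 2 + 2 * q * q + q ^ 2)) := by gcongr
        _ = 7 * (x * q) * (|p - q| * q) := by ring
        _ ≤ 7 * (x * q) * 1 := by gcongr
        _ = _ := mul_one _
    have t3 : |3 / 4 * u * p| ≤ 3 * (x * q) := by
      rw [abs_of_nonneg (by positivity)]
      calc 3 / 4 * u * p ≤ 3 / 4 * (2 * x) * (2 * q) := by gcongr
        _ = _ := by ring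
    have e : u * p ^ 3 + 3 / 4 * u * p - x * q ^ 3 =
        (u - x) * p ^ 3 + x * (p ^ 3 - q ^ 3) + 3 / 4 * u * p := by ring
    rw [Real.norm_eq_abs, e]
    have := abs_add_three ((u - x) * p ^ 3) (x * (p ^ 3 - q ^ 3)) (3 / 4 * u * p)
    linarith
  have hxI : x ∈ I := by
    have : 0 ≤ x / L := by positivity
    constructor <;> linarith
  have hyI : y ∈ I := by
    rw [abs_le] at hxy
    constructor <;> linarith
  have := (convex_Icc _ _).norm_image_sub_le_of_norm_hasDerivWithin_le hd hb hxI hyI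
  rw [Real.norm_eq_abs, Real.norm_eq_abs] at this
  refine le_trans (le_of_eq ?_) this
  rw [hsq32 L hL0.le]
  congr 1
  simp only [M]
  ring

/-- A Tauberian theorem with remainder for Dirichlet series with non-negative coefficients and an
algebraic singularity of order `5 / 2` at `s = 1`. -/
theorem exists_abs_sum_sub_le {a : ℕ → ℝ} (ha : ∀ n, 0 ≤ a n) (ha0 : a 0 = 0) {κ δ C : ℝ}
    (hs : ∀ c : ℝ, 1 < c → LSeriesSummable (fun n => (a n : ℂ)) c) (hδ : 0 < δ) (hC : 0 ≤ C)
    (hE : ∀ s : ℂ, 1 < s.re → s.re ≤ 1 + δ → ‖singularDiff a κ s‖ ≤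
      C * ((s.re - 1 + |s.im|) ^ (-(3 / 2) : ℝ) + (1 + |s.im|) ^ (1 / 4 : ℝ))) :
    ∃ C₂ L₀ : ℝ, 0 ≤ C₂ ∧ 2 ≤ L₀ ∧ ∀ L x : ℝ, L₀ ≤ L → x = Real.exp L →
      |∑ n ∈ Finset.Icc 1 ⌊x⌋₊, a n - κ * (x * L ^ (3 / 2 : ℝ))| ≤ C₂ * (x * √L) := by
  obtain ⟨C₁, L₀, hC₁, hL₀, hQ⟩ := exists_abs_rieszSum_sub_le ha0 hs hδ hC hE
  refine ⟨18 * |κ| + C₁, L₀, by positivity, hL₀, fun L x hL hx => ?_⟩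
  have hL2 : 2 ≤ L := hL₀.trans hL
  have hL0 : 0 < L := by linarith
  have hx0 : 0 < x := hx ▸ Real.exp_pos L
  -- A step this short keeps the variation of the main term within `O(x √L)`. The Riesz error `x² √L
  -- / L`, divided by `h`, has the same order.
  set h := x / L with hh
  have hh0 : 0 < h := by positivity
  have key : ∀ y : ℝ, |y - x| = h → |rieszSum a y - rieszSum a x -
      (y - x) * (κ * (x * L ^ (3 / 2 : ℝ)))| ≤ h * ((18 * |κ| + C₁) * (x * √L)) := by
    intro y hy
    have k1 := hQ L x y hL hx (by rw [hy])
    have k2 := abs_sq_mul_log_rpow_sub_le hL2 hx (y := y) (by rw [hy])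
    rw [hy] at k2
    have k3 := mul_le_mul_of_nonneg_left k2 (abs_nonneg κ)
    rw [← abs_mul] at k3
    have e : rieszSum a y - rieszSum a x - (y - x) * (κ * (x * L ^ (3 / 2 : ℝ))) =
      ((rieszSum a y - κ * (y ^ 2 * Real.log y ^ (3 / 2 : ℝ) / 2)) -
        (rieszSum a x - κ * (x ^ 2 * Real.log x ^ (3 / 2 : ℝ) / 2))) +
      κ * (y ^ 2 * Real.log y ^ (3 / 2 : ℝ) / 2 - x ^ 2 * Real.log x ^ (3 / 2 : ℝ) / 2 -
      (y - x) * (x * L ^ (3 / 2 : ℝ))) := by ring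
    rw [e]
    refine (abs_add_le _ _).trans ((add_le_add k1 k3).trans (le_of_eq ?_))
    rw [hh]
    ring
  set A := ∑ n ∈ Finset.Icc 1 ⌊x⌋₊, a n
  have up := mul_sum_le_rieszSum_sub ha hx0.le (by linarith : x ≤ x + h)
  have lo := rieszSum_sub_le_mul_sum ha ha0 (by linarith : x - h ≤ x)
  have ku := key (x + h) (by rw [add_sub_cancel_left, abs_of_pos hh0])
  have kl := key (x - h) (by rw [sub_sub_cancel_left, abs_neg, abs_of_pos hh0])
  rw [add_sub_cancel_left, abs_le] at ku
  rw [sub_sub_cancel_left, abs_le] at kl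
  rw [add_sub_cancel_left] at up
  rw [sub_sub_cancel] at lo
  rw [abs_le]
  constructor
  · refine le_of_mul_le_mul_left ?_ hh0
    linarith [kl.2]
  · refine le_of_mul_le_mul_left ?_ hh0
    linarith [ku.2]

/-! ### Removing the weight `(log n)²` -/

/-- Rankin's trick: each term is multiplied by `(x/n)^(3/2) ≥ 1`. -/
theorem exists_sum_le_mul_rpow {f : ℕ → ℝ} (hf : ∀ n, 0 ≤ f n)
    (hs : Summable fun n : ℕ => f n * (n : ℝ) ^ (-(3 / 2) : ℝ)) :
    ∃ G : ℝ, 0 ≤ G ∧ ∀ (x : ℝ) (s : Finset ℕ), 0 ≤ x → (∀ n ∈ s, 0 < n ∧ (n : ℝ) ≤ x) →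
      ∑ n ∈ s, f n ≤ G * x ^ (3 / 2 : ℝ) := by
  refine ⟨∑' n : ℕ, f n * (n : ℝ) ^ (-(3 / 2) : ℝ),
    tsum_nonneg fun n => mul_nonneg (hf n) (by positivity), fun x s hx h => ?_⟩
  calc ∑ n ∈ s, f n ≤ ∑ n ∈ s, f n * (n : ℝ) ^ (-(3 / 2) : ℝ) * x ^ (3 / 2 : ℝ) := by
        refine Finset.sum_le_sum fun n hn => ?_
        obtain ⟨hn0, hnx⟩ := h n hn
        have hn0 : (0 : ℝ) < n := by exact_mod_cast hn0
        rw [mul_assoc]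
        refine le_mul_of_one_le_right (hf n) ?_
        rw [Real.rpow_neg hn0.le, ← div_eq_inv_mul, one_le_div (by positivity)]
        gcongr
    _ = (∑ n ∈ s, f n * (n : ℝ) ^ (-(3 / 2) : ℝ)) * x ^ (3 / 2 : ℝ) := by rw [Finset.sum_mul]
    _ ≤ _ := by
        gcongr
        exact hs.sum_le_tsum _ fun n _ => mul_nonneg (hf n) (by positivity)

theorem sqrt_le_exp_quarter (L : ℝ) (hL : 0 ≤ L) : √L ≤ Real.exp (L / 4) := by
  rw [Real.sqrt_le_left (Real.exp_pos _).le, ← Real.exp_nat_mul]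
  have h1 := Real.add_one_le_exp (L / 2 - 1)
  have h2 : Real.exp (L / 2) = Real.exp (L / 2 - 1) * Real.exp 1 := by
    rw [← Real.exp_add]; congr 1; ring
  have h3 : ((2 : ℕ) : ℝ) * (L / 4) = L / 2 := by push_cast; ring
  have h4 : 2 < Real.exp 1 := by linarith [Real.exp_one_gt_d9]
  rw [h3, h2]
  nlinarith

theorem mem_Icc_floor_exp {L : ℝ} {n : ℕ} (hn : n ∈ Finset.Icc 1 ⌊Real.exp L⌋₊) :
    0 < n ∧ (n : ℝ) ≤ Real.exp L ∧ 0 ≤ Real.log n ∧ Real.log n ≤ L := by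
  rw [Finset.mem_Icc] at hn
  have h1 : (n : ℝ) ≤ Real.exp L := (Nat.le_floor_iff (Real.exp_pos L).le).mp hn.2
  have h0 : (0 : ℝ) < n := by exact_mod_cast hn.1
  exact ⟨hn.1, h1, Real.log_nonneg (by exact_mod_cast hn.1), (Real.log_le_iff_le_exp h0).mpr h1⟩

/-- A Chebyshev-type bound of the right order. For `n > exp (L/2)` the weight `(log n)²` is at least
`L²/4`; smaller `n` contribute `O(exp (3L/4))`. Writing `√(L + 1)` in place of `√L` keeps the bound
meaningful at `L = 0`, where the induction that uses it starts. -/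
theorem exists_sum_le {f : ℕ → ℝ} (hf : ∀ n, 0 ≤ f n)
    (hs : Summable fun n : ℕ => f n * (n : ℝ) ^ (-(3 / 2) : ℝ)) {κ C L₀ : ℝ} (hC : 0 ≤ C)
    (hL₀ : 2 ≤ L₀) (h : ∀ L : ℝ, L₀ ≤ L →
      |∑ n ∈ Finset.Icc 1 ⌊Real.exp L⌋₊, f n * Real.log n ^ 2 -
        κ * (Real.exp L * L ^ (3 / 2 : ℝ))| ≤ C * (Real.exp L * √L)) :
    ∃ D : ℝ, 0 ≤ D ∧ ∀ L : ℝ, 0 ≤ L →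
      ∑ n ∈ Finset.Icc 1 ⌊Real.exp L⌋₊, f n ≤ D * (Real.exp L / √(L + 1)) := by
  obtain ⟨G, hG0, hG⟩ := exists_sum_le_mul_rpow hf hs
  set D₁ : ℝ := 2 * (G + 4 * (|κ| + C))
  set D₂ : ℝ := G * Real.exp L₀ ^ (3 / 2 : ℝ) * √(L₀ + 1)
  have hD₁ : 0 ≤ D₁ := by positivity
  have hD₂ : 0 ≤ D₂ := by positivity
  refine ⟨D₁ + D₂, by positivity, fun L hL => ?_⟩
  set x := Real.exp L with hx
  have hx0 : 0 < x := Real.exp_pos L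
  have hx1 : 1 ≤ x := Real.one_le_exp hL
  have hr : 0 < √(L + 1) := Real.sqrt_pos.mpr (by linarith)
  rcases le_total L₀ L with hLL | hLL
  · have hL0 : 0 < L := by linarith
    have hq : 0 < √L := Real.sqrt_pos.mpr hL0
    have hq2 : √L ^ 2 = L := Real.sq_sqrt hL0.le
    set A := ∑ n ∈ Finset.Icc 1 ⌊x⌋₊, f n * Real.log n ^ 2
    have hA : A ≤ (|κ| + C) * (x * √L ^ 3) := by
      have h1 := (abs_le.mp (h L hLL)).2
      have h2 : L ^ (3 / 2 : ℝ) = √L ^ 3 := by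
        rw [Real.sqrt_eq_rpow, ← Real.rpow_natCast, ← Real.rpow_mul hL]; norm_num
      rw [h2] at h1
      have h3 : κ * (x * √L ^ 3) ≤ |κ| * (x * √L ^ 3) := by
        gcongr
        exact le_abs_self κ
      have h4 : √L ≤ √L ^ 3 := by
        refine le_self_pow₀ ?_ (by norm_num)
        rw [Real.one_le_sqrt]
        linarith
      have h5 : C * (x * √L) ≤ C * (x * √L ^ 3) := by gcongr
      linarith
    set P := (Finset.Icc 1 ⌊x⌋₊).filter fun n : ℕ => (n : ℝ) ≤ Real.exp (L / 2)
    have hsplit : ∑ n ∈ Finset.Icc 1 ⌊x⌋₊, f n ≤ ∑ n ∈ P, f n + 4 / L ^ 2 * A := by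
      rw [Finset.sum_filter, Finset.mul_sum, ← Finset.sum_add_distrib]
      refine Finset.sum_le_sum fun n hn => ?_
      obtain ⟨hn0, hnx, hl0, hl1⟩ := mem_Icc_floor_exp hn
      have hn0 : (0 : ℝ) < n := by exact_mod_cast hn0
      split_ifs with hc
      · have : 0 ≤ 4 / L ^ 2 * (f n * Real.log n ^ 2) :=
          mul_nonneg (by positivity) (mul_nonneg (hf n) (by positivity))
        linarith
      · have hlog : L / 2 ≤ Real.log n := by
          rw [Real.le_log_iff_exp_le hn0]
          exact (not_le.mp hc).le
        have h1 : 1 ≤ 4 / L ^ 2 * Real.log n ^ 2 := by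
          rw [div_mul_eq_mul_div, one_le_div (by positivity)]
          nlinarith
        calc f n ≤ f n * (4 / L ^ 2 * Real.log n ^ 2) := le_mul_of_one_le_right (hf n) h1
          _ = _ := by ring
    have hP : ∑ n ∈ P, f n ≤ G * (x / √L) := by
      have h1 := hG (Real.exp (L / 2)) P (Real.exp_pos _).le fun n hn => by
        rw [Finset.mem_filter] at hn
        exact ⟨(mem_Icc_floor_exp hn.1).1, hn.2⟩
      refine h1.trans ?_
      gcongr
      rw [le_div_iff₀ hq, ← Real.exp_mul]
      calc Real.exp (L / 2 * (3 / 2)) * √L ≤ Real.exp (L / 2 * (3 / 2)) * Real.exp (L / 4) := by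
            gcongr
            exact sqrt_le_exp_quarter L hL
        _ = x := by rw [← Real.exp_add, hx]; congr 1; ring
    have hmain : ∑ n ∈ Finset.Icc 1 ⌊x⌋₊, f n ≤ (G + 4 * (|κ| + C)) * (x / √L) := by
      calc ∑ n ∈ Finset.Icc 1 ⌊x⌋₊, f n
          ≤ G * (x / √L) + 4 / L ^ 2 * ((|κ| + C) * (x * √L ^ 3)) := by
            refine hsplit.trans ?_
            gcongr
        _ = _ := by
            nth_rewrite 2 [← hq2]
            field_simp
    have h2 : x / √L ≤ 2 * (x / √(L + 1)) := by
      rw [← mul_div_assoc, div_le_div_iff₀ hq hr]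
      have : √(L + 1) ≤ 2 * √L := by
        rw [Real.sqrt_le_left (by positivity), mul_pow, hq2]
        linarith
      calc x * √(L + 1) ≤ x * (2 * √L) := by gcongr
        _ = _ := by ring
    calc ∑ n ∈ Finset.Icc 1 ⌊x⌋₊, f n ≤ (G + 4 * (|κ| + C)) * (2 * (x / √(L + 1))) :=
          hmain.trans (by gcongr)
      _ = D₁ * (x / √(L + 1)) := by simp only [D₁]; ring
      _ ≤ _ := by gcongr; linarith
  · have h1 := hG x (Finset.Icc 1 ⌊x⌋₊) hx0.le fun n hn =>
      ⟨(mem_Icc_floor_exp hn).1, (mem_Icc_floor_exp hn).2.1⟩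
    refine h1.trans ?_
    calc G * x ^ (3 / 2 : ℝ) ≤ G * Real.exp L₀ ^ (3 / 2 : ℝ) := by
          gcongr
          exact Real.exp_le_exp.mpr hLL
      _ ≤ D₂ * (x / √(L + 1)) := by
          simp only [D₂]
          rw [mul_assoc]
          refine le_mul_of_one_le_right (by positivity) ?_
          rw [mul_div_assoc', one_le_div hr]
          calc √(L + 1) ≤ √(L₀ + 1) := by gcongr
            _ ≤ _ := le_mul_of_one_le_right (by positivity) hx1
      _ ≤ _ := by gcongr; linarith

/-- Induction in unit steps of `L` replaces an integral of the summatory function: lowering `L` by 1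
costs at most one plain sum. Since the bound shrinks by a factor `2/3` at each step, the constant 3
reproduces itself, as `3 * (2/3) + 1 = 3`. -/
theorem sum_mul_sub_log_le {f : ℕ → ℝ} (hf : ∀ n, 0 ≤ f n) {D : ℝ} (hD : 0 ≤ D)
    (h : ∀ L : ℝ, 0 ≤ L →
      ∑ n ∈ Finset.Icc 1 ⌊Real.exp L⌋₊, f n ≤ D * (Real.exp L / √(L + 1))) {L : ℝ} (hL : 0 ≤ L) :
    ∑ n ∈ Finset.Icc 1 ⌊Real.exp L⌋₊, f n * (L - Real.log n) ≤
      3 * D * (Real.exp L / √(L + 1)) := by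
  suffices H : ∀ k : ℕ, ∀ L : ℝ, 0 ≤ L → L < k + 1 →
      ∑ n ∈ Finset.Icc 1 ⌊Real.exp L⌋₊, f n * (L - Real.log n) ≤
      3 * D * (Real.exp L / √(L + 1)) from H ⌊L⌋₊ L hL (Nat.lt_floor_add_one L)
  intro k
  induction k with
  | zero =>
    intro L hL hL1
    have hL1 : L < 1 := by simpa using hL1
    have h0 : 0 ≤ D * (Real.exp L / √(L + 1)) := by positivity
    calc ∑ n ∈ Finset.Icc 1 ⌊Real.exp L⌋₊, f n * (L - Real.log n)
        ≤ ∑ n ∈ Finset.Icc 1 ⌊Real.exp L⌋₊, f n := by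
          refine Finset.sum_le_sum fun n hn => mul_le_of_le_one_right (hf n) ?_
          linarith [(mem_Icc_floor_exp hn).2.2.1]
      _ ≤ _ := (h L hL).trans (by linarith)
  | succ k ih =>
    intro L hL hLk
    rcases lt_or_ge L (k + 1) with hlt | hge
    · exact ih L hL hlt
    have hk : (0 : ℝ) ≤ k := k.cast_nonneg
    have hL1 : 0 ≤ L - 1 := by linarith
    have ih' := ih (L - 1) hL1 (by push_cast at hLk; linarith)
    have hsub : Finset.Icc 1 ⌊Real.exp (L - 1)⌋₊ ⊆ Finset.Icc 1 ⌊Real.exp L⌋₊ := by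
      refine Finset.Icc_subset_Icc le_rfl (Nat.floor_le_floor ?_)
      exact Real.exp_le_exp.mpr (by linarith)
    have hstep : ∑ n ∈ Finset.Icc 1 ⌊Real.exp L⌋₊, f n * (L - Real.log n) ≤
        ∑ n ∈ Finset.Icc 1 ⌊Real.exp (L - 1)⌋₊, f n * (L - 1 - Real.log n) +
          ∑ n ∈ Finset.Icc 1 ⌊Real.exp L⌋₊, f n := by
      rw [← Finset.sum_sdiff hsub, ← Finset.sum_sdiff (f := f) hsub]
      have e1 : ∑ n ∈ Finset.Icc 1 ⌊Real.exp L⌋₊ \ Finset.Icc 1 ⌊Real.exp (L - 1)⌋₊,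
          f n * (L - Real.log n) ≤
          ∑ n ∈ Finset.Icc 1 ⌊Real.exp L⌋₊ \ Finset.Icc 1 ⌊Real.exp (L - 1)⌋₊, f n := by
        refine Finset.sum_le_sum fun n hn => mul_le_of_le_one_right (hf n) ?_
        rw [Finset.mem_sdiff] at hn
        obtain ⟨hn0, -, -, -⟩ := mem_Icc_floor_exp hn.1
        have : Real.exp (L - 1) < n := by
          refine Nat.lt_of_floor_lt ?_
          by_contra hcon
          exact hn.2 (Finset.mem_Icc.mpr ⟨hn0, not_lt.mp hcon⟩)
        have := (Real.lt_log_iff_exp_lt (by exact_mod_cast hn0)).mpr this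
        linarith
      have e2 : ∑ n ∈ Finset.Icc 1 ⌊Real.exp (L - 1)⌋₊, f n * (L - Real.log n) =
          ∑ n ∈ Finset.Icc 1 ⌊Real.exp (L - 1)⌋₊, f n * (L - 1 - Real.log n) +
          ∑ n ∈ Finset.Icc 1 ⌊Real.exp (L - 1)⌋₊, f n := by
        rw [← Finset.sum_add_distrib]
        exact Finset.sum_congr rfl fun n _ => by ring
      linarith
    have hr : 0 < √(L + 1) := Real.sqrt_pos.mpr (by linarith)
    have hr' : 0 < √(L - 1 + 1) := Real.sqrt_pos.mpr (by linarith)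
    have hexp : Real.exp (L - 1) / √(L - 1 + 1) ≤ 2 / 3 * (Real.exp L / √(L + 1)) := by
      rw [Real.exp_sub, div_div, mul_div_assoc', div_le_div_iff₀ (by positivity) hr]
      have e1 : √(L + 1) ≤ 3 / 2 * √(L - 1 + 1) := by
        rw [Real.sqrt_le_left (by positivity), mul_pow, Real.sq_sqrt (by linarith)]
        linarith
      have e2 : 9 / 4 ≤ Real.exp 1 := by linarith [Real.exp_one_gt_d9]
      calc Real.exp L * √(L + 1) ≤ Real.exp L * (3 / 2 * √(L - 1 + 1)) := by gcongr
        _ = 2 / 3 * Real.exp L * (9 / 4 * √(L - 1 + 1)) := by ring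
        _ ≤ 2 / 3 * Real.exp L * (Real.exp 1 * √(L - 1 + 1)) := by gcongr
    have hS := h L hL
    calc _ ≤ 3 * D * (Real.exp (L - 1) / √(L - 1 + 1)) + D * (Real.exp L / √(L + 1)) := by
          linarith
      _ ≤ 3 * D * (2 / 3 * (Real.exp L / √(L + 1))) + D * (Real.exp L / √(L + 1)) := by gcongr
      _ = _ := by ring

/-- Passing from `∑ f n (log n)²` to `∑ f n` by partial summation. -/
theorem exists_abs_sum_sub_div_sqrt_le {f : ℕ → ℝ} (hf : ∀ n, 0 ≤ f n)
    (hs : Summable fun n : ℕ => f n * (n : ℝ) ^ (-(3 / 2) : ℝ)) {κ C L₀ : ℝ} (hC : 0 ≤ C)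
    (hL₀ : 2 ≤ L₀) (h : ∀ L : ℝ, L₀ ≤ L →
      |∑ n ∈ Finset.Icc 1 ⌊Real.exp L⌋₊, f n * Real.log n ^ 2 -
        κ * (Real.exp L * L ^ (3 / 2 : ℝ))| ≤ C * (Real.exp L * √L)) :
    ∃ D : ℝ, 0 ≤ D ∧ ∀ L : ℝ, L₀ ≤ L →
      |∑ n ∈ Finset.Icc 1 ⌊Real.exp L⌋₊, f n - κ * (Real.exp L / √L)| ≤
        D * (Real.exp L / √L / L) := by
  obtain ⟨D, hD, hS⟩ := exists_sum_le hf hs hC hL₀ h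
  refine ⟨C + 6 * D, by positivity, fun L hL => ?_⟩
  have hL0 : 0 < L := by linarith
  have hT := sum_mul_sub_log_le hf hD hS hL0.le
  have hA := h L hL
  set x := Real.exp L
  have hx0 : 0 < x := Real.exp_pos L
  set q := √L
  have hq : 0 < q := Real.sqrt_pos.mpr hL0
  have hq2 : q ^ 2 = L := Real.sq_sqrt hL0.le
  have h2 : L ^ (3 / 2 : ℝ) = q ^ 3 := by
    simp only [q]
    rw [Real.sqrt_eq_rpow, ← Real.rpow_natCast, ← Real.rpow_mul hL0.le]; norm_num
  rw [h2] at hA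
  set A := ∑ n ∈ Finset.Icc 1 ⌊x⌋₊, f n * Real.log n ^ 2
  set S := ∑ n ∈ Finset.Icc 1 ⌊x⌋₊, f n
  set T := ∑ n ∈ Finset.Icc 1 ⌊x⌋₊, f n * (L - Real.log n)
  -- Factor `L² - (log n)²` and bound `L + log n` by `2L`. As `T` is of the same order as `S`, a
  -- factor `L` is gained over `L² S`.
  have hdiff : |L ^ 2 * S - A| ≤ 2 * L * T := by
    have e : L ^ 2 * S - A = ∑ n ∈ Finset.Icc 1 ⌊x⌋₊,
        f n * (L - Real.log n) * (L + Real.log n) := by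
      simp only [S, A]
      rw [Finset.mul_sum, ← Finset.sum_sub_distrib]
      exact Finset.sum_congr rfl fun n _ => by ring
    rw [e, abs_of_nonneg]
    · simp only [T]
      rw [Finset.mul_sum]
      refine Finset.sum_le_sum fun n hn => ?_
      obtain ⟨-, -, hl0, hl1⟩ := mem_Icc_floor_exp hn
      have : 0 ≤ f n * (L - Real.log n) := mul_nonneg (hf n) (by linarith)
      nlinarith
    · refine Finset.sum_nonneg fun n hn => ?_
      obtain ⟨-, -, hl0, hl1⟩ := mem_Icc_floor_exp hn
      exact mul_nonneg (mul_nonneg (hf n) (by linarith)) (by linarith)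
  have hT' : 2 * L * T ≤ 6 * D * (x * q) := by
    have h1 : x / √(L + 1) ≤ x / q :=
      div_le_div_of_nonneg_left hx0.le hq (Real.sqrt_le_sqrt (by linarith))
    calc 2 * L * T ≤ 2 * L * (3 * D * (x / q)) := by
          gcongr
          exact hT.trans (by gcongr)
      _ = _ := by rw [← hq2]; field_simp; ring
  have hkey : |L ^ 2 * S - κ * (x * q ^ 3)| ≤ (C + 6 * D) * (x * q) := by
    have := abs_sub_le (L ^ 2 * S) A (κ * (x * q ^ 3))
    linarith
  have e : S - κ * (x / q) = (L ^ 2 * S - κ * (x * q ^ 3)) / L ^ 2 := by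
    rw [← hq2]; field_simp
  rw [e, abs_div, abs_of_pos (by positivity : 0 < L ^ 2), div_le_iff₀ (by positivity)]
  refine hkey.trans (le_of_eq ?_)
  rw [← hq2]
  field_simp

/-! ### Assembly: from the factorisation to the asymptotic formula -/

/-- The part of the hypotheses on `f` and `Φ` that the asymptotic formula depends on. -/
structure IsSqrtZetaFactor (f : ℕ → ℝ) (Φ : ℂ → ℂ) : Prop where
  hasSum : ∀ s : ℂ, 1 < s.re → LSeriesHasSum (fun n => (f n : ℂ)) s (sqrtZeta s * Φ s)
  differentiableOn : DifferentiableOn ℂ Φ {s : ℂ | 1 / 2 < s.re}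
  bounded : ∃ B : ℝ, ∀ s : ℂ, 3 / 4 ≤ s.re → ‖Φ s‖ ≤ B

namespace IsSqrtZetaFactor

variable {f : ℕ → ℝ} {Φ Ψ : ℂ → ℂ}

theorem tendsto_one_add_inv :
    Tendsto (fun n : ℕ => ((1 + 1 / ((n : ℝ) + 1) : ℝ) : ℂ)) atTop (nhds 1) := by
  have h1 : Tendsto (fun n : ℕ => 1 + 1 / ((n : ℝ) + 1)) atTop (nhds 1) := by
    simpa using tendsto_one_div_add_atTop_nhds_zero_nat.const_add (1 : ℝ)
  have h2 := (Complex.continuous_ofReal.tendsto 1).comp h1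
  rwa [Complex.ofReal_one] at h2

theorem tendsto_apply (h : IsSqrtZetaFactor f Φ) :
    Tendsto (fun n : ℕ => Φ ((1 + 1 / ((n : ℝ) + 1) : ℝ) : ℂ)) atTop (nhds (Φ 1)) := by
  have h1 : (1 : ℂ) ∈ {s : ℂ | 1 / 2 < s.re} := by
    show (1 / 2 : ℝ) < 1
    norm_num
  exact ((h.differentiableOn 1 h1).differentiableAt
    ((isOpen_re_gt _).mem_nhds h1)).continuousAt.tendsto.comp tendsto_one_add_inv

/-- For `Re s > 1` the factor is the Dirichlet series divided by the non-vanishing `√ζ`, so it is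
determined by `f`; the value at 1 follows by continuity. -/
theorem apply_one_eq (h : IsSqrtZetaFactor f Φ) (h' : IsSqrtZetaFactor f Ψ) : Φ 1 = Ψ 1 := by
  refine tendsto_nhds_unique h.tendsto_apply (h'.tendsto_apply.congr fun n => ?_)
  have hn : (1 : ℝ) < (((1 + 1 / ((n : ℝ) + 1) : ℝ) : ℂ)).re := by
    rw [Complex.ofReal_re]
    have : (0 : ℝ) < 1 / ((n : ℝ) + 1) := by positivity
    linarith
  exact (mul_left_cancel₀ (sqrtZeta_ne_zero _)
    ((h.hasSum _ hn).unique (h'.hasSum _ hn))).symm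

/-- On the real axis to the right of 1 the Dirichlet series is real and `√ζ` is positive, so `Φ` is
real there and in the limit at 1. -/
theorem apply_one_im (h : IsSqrtZetaFactor f Φ) : (Φ 1).im = 0 := by
  refine tendsto_nhds_unique ((Complex.continuous_im.tendsto _).comp h.tendsto_apply)
    (tendsto_const_nhds.congr fun n => ?_)
  set σ : ℝ := 1 + 1 / ((n : ℝ) + 1)
  have hσ : 1 < σ := by
    have : (0 : ℝ) < 1 / ((n : ℝ) + 1) := by positivity
    simp only [σ]
    linarith
  obtain ⟨y, hy, hyeq⟩ := sqrtZeta_ofReal hσ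
  have hs := h.hasSum σ (by simpa using hσ)
  rw [LSeriesHasSum] at hs
  have him := Complex.hasSum_im hs
  have hz : ∀ n : ℕ, (LSeries.term (fun n => (f n : ℂ)) σ n).im = 0 := fun n => by
    rcases eq_or_ne n 0 with rfl | hn
    · simp
    · rw [LSeries.term_of_ne_zero hn, ← Complex.ofReal_natCast,
        ← Complex.ofReal_cpow n.cast_nonneg, ← Complex.ofReal_div, Complex.ofReal_im]
  simp_rw [hz] at him
  have h0 := him.unique hasSum_zero
  rw [hyeq, Complex.im_ofReal_mul] at h0
  exact ((mul_eq_zero.mp h0).resolve_left hy.ne').symm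

theorem abscissa_le (h : IsSqrtZetaFactor f Φ) :
    LSeries.abscissaOfAbsConv (fun n => (f n : ℂ)) ≤ 1 :=
  LSeries.abscissaOfAbsConv_le_of_forall_lt_LSeriesSummable fun y hy =>
    (h.hasSum y (by simpa using hy)).LSeriesSummable

theorem logMul_two_eq (f : ℕ → ℝ) : (LSeries.logMul^[2] fun n => (f n : ℂ)) =
    fun n => ((f n * Real.log n ^ 2 : ℝ) : ℂ) := by
  ext n
  simp only [Function.iterate_succ, Function.iterate_zero, Function.comp_apply, id,
    LSeries.logMul]
  rw [← Complex.natCast_log]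
  push_cast
  ring

theorem abscissa_lt (h : IsSqrtZetaFactor f Φ) {s : ℂ} (hs : 1 < s.re) :
    LSeries.abscissaOfAbsConv (fun n => (f n : ℂ)) < s.re :=
  h.abscissa_le.trans_lt (by exact_mod_cast hs)

theorem LSeriesSummable_log_sq (h : IsSqrtZetaFactor f Φ) {s : ℂ} (hs : 1 < s.re) :
    LSeriesSummable (fun n => ((f n * Real.log n ^ 2 : ℝ) : ℂ)) s := by
  rw [← logMul_two_eq]
  refine LSeriesSummable_of_abscissaOfAbsConv_lt_re ?_
  rw [LSeries.absicssaOfAbsConv_logPowMul]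
  exact h.abscissa_lt hs

theorem LSeries_log_sq (h : IsSqrtZetaFactor f Φ) {s : ℂ} (hs : 1 < s.re) :
    LSeries (fun n => ((f n * Real.log n ^ 2 : ℝ) : ℂ)) s =
      deriv (deriv fun z => sqrtZeta z * Φ z) s := by
  have hd := LSeries_iteratedDeriv 2 (h.abscissa_lt hs)
  rw [logMul_two_eq] at hd
  have hev : LSeries (fun n => (f n : ℂ)) =ᶠ[nhds s] fun z => sqrtZeta z * Φ z := by
    filter_upwards [(isOpen_re_gt 1).mem_nhds hs] with z hz using (h.hasSum z hz).LSeries_eq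
  rw [← hev.deriv.deriv_eq]
  simpa [iteratedDeriv_succ] using hd.symm

theorem summable_rpow (h : IsSqrtZetaFactor f Φ) (hf : ∀ n, 0 ≤ f n) :
    Summable fun n : ℕ => f n * (n : ℝ) ^ (-(3 / 2) : ℝ) := by
  have h1 := (h.hasSum (3 / 2 : ℝ)
    (by rw [Complex.ofReal_re]; norm_num)).LSeriesSummable.norm
  refine (summable_congr_cofinite ?_).mp h1
  filter_upwards [(Set.finite_singleton 0).compl_mem_cofinite] with n hn
  have hn : n ≠ 0 := hn
  rw [LSeries.norm_term_eq, if_neg hn, Complex.norm_real, Real.norm_of_nonneg (hf n),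
    Complex.ofReal_re, Real.rpow_neg n.cast_nonneg, div_eq_mul_inv]

theorem _root_.Real.Gamma_five_halves : Real.Gamma (5 / 2) = 3 / 4 * √Real.pi := by
  have h1 := Real.Gamma_add_one (show (1 / 2 : ℝ) ≠ 0 by norm_num)
  have h2 := Real.Gamma_add_one (show (3 / 2 : ℝ) ≠ 0 by norm_num)
  norm_num at h1 h2
  rw [h2, h1, Real.Gamma_one_half_eq]
  ring

theorem exists_abs_sum_sub_le (h : IsSqrtZetaFactor f Φ) (hf : ∀ n, 0 ≤ f n) :
    ∃ K : ℝ, ∀ x : ℝ, 1 < x →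
      |(∑ n ∈ Finset.Icc 1 ⌊x⌋₊, f n) / (x / √(Real.log x)) - (Φ 1).re / √Real.pi| ≤
        K / Real.log x := by
  set κ : ℝ := (Φ 1).re / √Real.pi
  have hpi : √Real.pi ≠ 0 := (Real.sqrt_pos.mpr Real.pi_pos).ne'
  set a : ℕ → ℝ := fun n => f n * Real.log n ^ 2
  have ha : ∀ n, 0 ≤ a n := fun n => mul_nonneg (hf n) (sq_nonneg _)
  have ha0 : a 0 = 0 := by simp [a]
  -- Since `Γ(5/2) = (3/4) √π`, the singular coefficient `(3/8) Φ(1)` corresponds to `κ = Φ(1)/√π`.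
  have hκ : ((κ * Real.Gamma (5 / 2) / 2 : ℝ) : ℂ) = 3 / 8 * Φ 1 := by
    have hre : ((Φ 1).re : ℂ) = Φ 1 := Complex.ext rfl (by simp [h.apply_one_im])
    have : κ * Real.Gamma (5 / 2) / 2 = 3 / 8 * (Φ 1).re := by
      rw [Real.Gamma_five_halves]
      simp only [κ]
      field_simp
      ring
    rw [this]
    push_cast
    rw [hre]
  obtain ⟨B, hB⟩ := h.bounded
  obtain ⟨δ, C, hδ, -, hC, hE⟩ := exists_norm_deriv_deriv_sub_le h.differentiableOn hB
  obtain ⟨C₂, L₀, hC₂, hL₀, hA⟩ := _root_.exists_abs_sum_sub_le (κ := κ) ha ha0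
    (fun c hc => h.LSeriesSummable_log_sq (by simpa using hc)) hδ hC fun s hs hs2 => by
      rw [singularDiff, hκ, h.LSeries_log_sq hs]
      exact hE s hs hs2
  obtain ⟨D, hD, hfin⟩ := exists_abs_sum_sub_div_sqrt_le (f := f) hf (h.summable_rpow hf) hC₂ hL₀
    fun L hL => hA L _ hL rfl
  set M := ∑ n ∈ Finset.Icc 1 ⌊Real.exp L₀⌋₊, f n
  have hM : 0 ≤ M := Finset.sum_nonneg fun n _ => hf n
  -- The second summand covers the range `log x ≤ L₀`, where the normalised sum is at most `M √L₀`.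
  refine ⟨D + (M * √L₀ + |κ|) * L₀, fun x hx => ?_⟩
  have hx0 : 0 < x := by linarith
  set L := Real.log x with hL
  have hL0 : 0 < L := Real.log_pos hx
  have hxe : Real.exp L = x := Real.exp_log hx0
  have hq : 0 < √L := Real.sqrt_pos.mpr hL0
  set S := ∑ n ∈ Finset.Icc 1 ⌊x⌋₊, f n
  have hS0 : 0 ≤ S := Finset.sum_nonneg fun n _ => hf n
  rw [le_div_iff₀ hL0]
  rcases le_total L₀ L with hle | hle
  · have h1 := hfin L hle
    rw [hxe] at h1
    have hm : 0 < x / √L := by positivity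
    have e : S / (x / √L) - κ = (S - κ * (x / √L)) / (x / √L) := by field_simp
    rw [e, abs_div, abs_of_pos hm, div_mul_eq_mul_div, div_le_iff₀ hm]
    have h2 := mul_le_mul_of_nonneg_right h1 hL0.le
    have e2 : D * (x / √L / L) * L = D * (x / √L) := by field_simp
    rw [e2] at h2
    have : 0 ≤ (M * √L₀ + |κ|) * L₀ * (x / √L) := by positivity
    linarith
  · have hSM : S ≤ M := by
      refine Finset.sum_le_sum_of_subset_of_nonneg (Finset.Icc_subset_Icc le_rfl
        (Nat.floor_le_floor ?_)) fun n _ _ => hf n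
      rw [← hxe]
      exact Real.exp_le_exp.mpr hle
    have h1 : S / (x / √L) ≤ M * √L₀ := by
      rw [div_div_eq_mul_div]
      calc S * √L / x ≤ S * √L := div_le_self (by positivity) hx.le
        _ ≤ M * √L₀ := by gcongr
    have h2 : |S / (x / √L) - κ| ≤ M * √L₀ + |κ| := by
      refine (abs_sub _ _).trans ?_
      rw [abs_of_nonneg (by positivity)]
      linarith
    calc |S / (x / √L) - κ| * L ≤ (M * √L₀ + |κ|) * L₀ := by gcongr
      _ ≤ _ := le_add_of_nonneg_left hD

end IsSqrtZetaFactor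

theorem lemma9 (f : ArithmeticFunction ℝ) (hmul : f.IsMultiplicative) (hnonneg : ∀ n, 0 ≤ f n) :
    ∃ K : ℝ, ∀ (ε c B : ℝ) (Φ : ℂ → ℂ), 0 < ε → ε < 1 / 2 → 0 < c →
      (fun n : ℕ => f n) =O[atTop] (fun n : ℕ => (n : ℝ) ^ ε) →
      (∀ s : ℂ, 1 < s.re → LSeriesHasSum (fun n => (f n : ℂ)) s (sqrtZeta s * Φ s)) →
      DifferentiableOn ℂ Φ {s : ℂ | 1 / 2 < s.re} →
      (∀ s : ℂ, 1 / 2 < s.re → ‖Φ s‖ ≤ B * max 1 ((s.re - 1 / 2) ^ (-c))) →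
      ∀ x : ℝ, 1 < x → ∃ r : ℂ, ‖r‖ ≤ K / Real.log x ∧
        ((∑ n ∈ Finset.Icc 1 ⌊x⌋₊, f n : ℝ) : ℂ) =
          ((x / √(Real.log x) : ℝ) : ℂ) * (Φ 1 / ((√Real.pi : ℝ) : ℂ) + r) := by
  have hfactor : ∀ (c B : ℝ) (Φ : ℂ → ℂ), 0 < c →
      (∀ s : ℂ, 1 < s.re → LSeriesHasSum (fun n => (f n : ℂ)) s (sqrtZeta s * Φ s)) →
      DifferentiableOn ℂ Φ {s : ℂ | 1 / 2 < s.re} →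
      (∀ s : ℂ, 1 / 2 < s.re → ‖Φ s‖ ≤ B * max 1 ((s.re - 1 / 2) ^ (-c))) →
      IsSqrtZetaFactor (fun n => f n) Φ := by
    intro c B Φ hc hsum hd hB
    refine ⟨hsum, hd, B * max 1 ((1 / 4) ^ (-c)), fun s hs => (hB s (by linarith)).trans ?_⟩
    have hB0 : 0 ≤ B := by
      have h1 := (norm_nonneg _).trans (hB 1 (by norm_num))
      exact nonneg_of_mul_nonneg_left h1 (by positivity)
    refine mul_le_mul_of_nonneg_left (max_le_max le_rfl ?_) hB0
    exact Real.rpow_le_rpow_of_nonpos (by norm_num) (by linarith) (by linarith)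
  -- The constant must precede the choice of `Φ`. It is taken from one admissible `Ψ`, and every
  -- other admissible `Φ` has the same value at 1. If none exists, the claim is vacuous.
  by_cases hex : ∃ Φ, IsSqrtZetaFactor (fun n => f n) Φ
  · obtain ⟨Ψ, hΨ⟩ := hex
    obtain ⟨K, hK⟩ := hΨ.exists_abs_sum_sub_le hnonneg
    refine ⟨K, fun ε c B Φ _ _ hc _ hsum hd hB x hx => ?_⟩
    have hΦ := hfactor c B Φ hc hsum hd hB
    have hre : ((Ψ 1).re : ℂ) = Φ 1 := by
      rw [hΦ.apply_one_eq hΨ]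
      exact Complex.ext rfl (by simp [hΨ.apply_one_im])
    refine ⟨(((∑ n ∈ Finset.Icc 1 ⌊x⌋₊, f n) / (x / √(Real.log x)) -
      (Ψ 1).re / √Real.pi : ℝ) : ℂ), ?_, ?_⟩
    · rw [Complex.norm_real]
      exact hK x hx
    · have hm : x / √(Real.log x) ≠ 0 :=
        (div_pos (by linarith) (Real.sqrt_pos.mpr (Real.log_pos hx))).ne'
      rw [← hre, ← Complex.ofReal_div, ← Complex.ofReal_add, ← Complex.ofReal_mul,
        add_sub_cancel, mul_div_cancel₀ _ hm]
  · exact ⟨0, fun ε c B Φ _ _ hc _ hsum hd hB => (hex ⟨Φ, hfactor c B Φ hc hsum hd hB⟩).elim⟩
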